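/- **Setting.** For every $n\ge 2$ let $\mathcal P_n$ be a Borel probability measure on $\mathbb R\times\mathbb R^{p_n}$ (where $p_n\in\mathbb N$ may depend on $n$), and let $(y_1,x_1),\dots,(y_{n+1},x_{n+1})$ be i.i.d. random pairs with distribution $\mathcal P_n$; all quantities may depend on $n$, which is suppressed in the notation. The training data are $T_n=(y_i,x_i)_{i=1}^n$, and $T_n^{\setminus i}$ is $T_n$ with the $i$-th pair removed. A prediction algorithm is a family of Borel measurable functions $\mathcal A_{p,n}:\mathbb R^p\times\mathbb R^{(p+1)n}\to\mathbb R$ (no symmetry in the training data is assumed). Put $\hat y_{n+1}=\mathcal A_{p_n,n}(x_{n+1},T_n)$, $\hat y_j^{\setminus i}=\mathcal A_{p_n,n-1}(x_j,T_n^{\setminus i})$ for $1\le i\le n$, $1\le j\le n+1$, and let $\hat u_i=y_i-\hat y_i^{\setminus i}$ be the leave-one-out residuals, with empirical distribution function $\widehat F_n(t)=\frac1n\sum_{i=1}^n \mathbf 1\{\hat u_i\le t\}$. For $\alpha\in\mathbb R$ and a function $F:\mathbb R\to[0,1]$ let $Q_\alpha(F)=\inf\{x\in\mathbb R: F(x)\ge\alpha\}\in[-\infty,\infty]$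 (so $\inf\emptyset=+\infty$). For $\delta\in\mathbb R$ the $\delta$-distorted Jackknife prediction interval is $$PI_{\alpha_1,\alpha_2}(\delta)=\hat y_{n+1}+\bigl[Q_{\alpha_1}(\widehat F_n)-\delta,\;Q_{\alpha_2}(\widehat F_n)+\delta\bigr],\qquad [a,b]=\emptyset \text{ if } a>b .$$ Conditional probabilities given $T_n$ are taken with respect to a regular conditional distribution of $(y_{n+1},x_{n+1})$ given $T_n$. **Continuous case assumption (CC).** (a) For every $n\ge2$ and $\mathcal P_n^x$-almost every $x$, where $\mathcal P_n^x$ is the distribution of $x_1$, the conditional distribution of $y_1$ given $x_1=x$ is absolutely continuous with respect to Lebesgue measure, with a density $f_{y_1\|x_1=x}$ whose supremum norm $\|f_{y_1\|x_1=x}\|_\infty$ (the essential supremum, i.e. the smallest supremum over the versions of the density) is finite. (b) The sequence of random variables $\|f_{y_1\|x_1}\|_\infty$, $n\ge2$, is stochastically bounded. **Theorem.** Suppose that the prediction error $y_{n+1}-\hat y_{n+1}$, $n\ge2$, is stochastically bounded, and that the predictor is asymptotically out-of-sample stable, i.e. $$\lim_{n\to\infty}\frac1n\sum_{i=1}^n\mathbb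 P\bigl(|\hat y_{n+1}-\hat y_{n+1}^{\setminus i}|\ge\epsilon\bigr)=0\quad\text{for all }\epsilon>0 .$$ (i) For every $\delta>0$ and every $\epsilon>0$, $$\lim_{n\to\infty}\mathbb P\Bigl(\inf_{0\le\alpha_1\le\alpha_2\le1}\bigl[\mathbb P(y_{n+1}\in PI_{\alpha_1,\alpha_2}(\delta)\mid T_n)-(\alpha_2-\alpha_1)\bigr]\ge-\epsilon\Bigr)=1$$ and $$\lim_{n\to\infty}\mathbb P\Bigl(\sup_{0\le\alpha_1\le\alpha_2\le1}\bigl[\mathbb P(y_{n+1}\in PI_{\alpha_1,\alpha_2}(-\delta)\mid T_n)-(\alpha_2-\alpha_1)\bigr]\le\epsilon\Bigr)=1 .$$ (ii) If, in addition, CC holds, then $$\lim_{n\to\infty}\mathbb E\Bigl(\sup_{0\le\alpha_1\le\alpha_2\le1}\bigl|\mathbb P(y_{n+1}\in PI_{\alpha_1,\alpha_2}(0)\mid T_n)-(\alpha_2-\alpha_1)\bigr|\Bigr)=0 ,$$ where the random variable inside the expectation is integrable for every $n\ge2$. -/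

import Mathlib

open MeasureTheory ProbabilityTheory Filter Topology
open scoped ENNReal NNReal

noncomputable section

namespace Jackknife

/-- A response-feature pair `(y, x)` in `ℝ × ℝ^p`. Only the Borel structure of `ℝ^p` matters. -/
abbrev Obs (p : ℕ) : Type := ℝ × (Fin p → ℝ)

/-- A prediction algorithm: for every dimension `p` and every sample size `n`, a map that sends a
feature vector in `ℝ^p` and `n` response-feature pairs to a real prediction. -/
abbrev Algorithm : Type := ∀ p n : ℕ, (Fin p → ℝ) → (Fin n → Obs p) → ℝ

/-- The training data with the `i`-th entry removed (the order of the others is kept). -/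
def leaveOut {E : Type*} {n : ℕ} (T : Fin n → E) (i : Fin n) : Fin (n - 1) → E :=
  fun k => if k.1 < i.1 then T ⟨k.1, by omega⟩ else T ⟨k.1 + 1, by omega⟩

/-- The prediction at the feature vector `x` from all the training data. -/
def pred (A : Algorithm) {p n : ℕ} (T : Fin n → Obs p) (x : Fin p → ℝ) : ℝ :=
  A p n x T

/-- The prediction at the feature vector `x` from the training data without the `i`-th pair. -/
def predLoo (A : Algorithm) {p n : ℕ} (T : Fin n → Obs p) (i : Fin n) (x : Fin p → ℝ) : ℝ :=
  A p (n - 1) x (leaveOut T i)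

/-- The `i`-th leave-one-out residual. -/
def residual (A : Algorithm) {p n : ℕ} (T : Fin n → Obs p) (i : Fin n) : ℝ :=
  (T i).1 - predLoo A T i (T i).2

/-- The empirical distribution function of the leave-one-out residuals. -/
def ecdf (A : Algorithm) {p n : ℕ} (T : Fin n → Obs p) (t : ℝ) : ℝ :=
  (1 / (n : ℝ)) * ∑ i : Fin n, Set.indicator (Set.Iic t) (fun _ => (1 : ℝ)) (residual A T i)

/-- The `α`-quantile `inf {x ∈ ℝ : F x ≥ α}` in `[-∞, ∞]`, with `inf ∅ = +∞`. -/
def quantile (F : ℝ → ℝ) (α : ℝ) : EReal :=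
  sInf ((fun x : ℝ => (x : EReal)) '' {x : ℝ | α ≤ F x})

/-- The real points of the `δ`-distorted Jackknife prediction interval
`ŷ + [Q_{α₁} - δ, Q_{α₂} + δ]` at the feature vector `x`; it is empty if the lower end exceeds the
upper one. -/
def predInterval (A : Algorithm) {p n : ℕ} (T : Fin n → Obs p) (x : Fin p → ℝ)
    (α₁ α₂ δ : ℝ) : Set ℝ :=
  {y : ℝ | (y : EReal) ∈ Set.Icc
    ((pred A T x : EReal) + (quantile (ecdf A T) α₁ - (δ : EReal)))
    ((pred A T x : EReal) + (quantile (ecdf A T) α₂ + (δ : EReal)))}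

section Random

variable {Ω : Type*} [MeasurableSpace Ω]

/-- The training data: the first `n` of the `n + 1` random pairs. -/
def train {p n : ℕ} (Z : Fin (n + 1) → Ω → Obs p) (ω : Ω) : Fin n → Obs p :=
  fun i => Z i.castSucc ω

/-- The new pair `(y_{n+1}, x_{n+1})`: the last of the `n + 1` random pairs. -/
def newObs {p n : ℕ} (Z : Fin (n + 1) → Ω → Obs p) (ω : Ω) : Obs p :=
  Z (Fin.last n) ω

/-- The predictor `ŷ_{n+1}`. -/
def yHat (A : Algorithm) {p n : ℕ} (Z : Fin (n + 1) → Ω → Obs p) (ω : Ω) : ℝ :=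
  pred A (train Z ω) (newObs Z ω).2

/-- The leave-one-out predictor of `y_{n+1}` that does not use the `i`-th pair. -/
def yHatLoo (A : Algorithm) {p n : ℕ} (Z : Fin (n + 1) → Ω → Obs p) (i : Fin n) (ω : Ω) : ℝ :=
  predLoo A (train Z ω) i (newObs Z ω).2

/-- The prediction error `y_{n+1} - ŷ_{n+1}`. -/
def predError (A : Algorithm) {p n : ℕ} (Z : Fin (n + 1) → Ω → Obs p) (ω : Ω) : ℝ :=
  (newObs Z ω).1 - yHat A Z ω

/-- The conditional probability, given the training data, that the `δ`-distorted Jackknife interval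
contains `y_{n+1}`. It is taken with respect to a regular conditional distribution of
`(y_{n+1}, x_{n+1})` given the training data, so that one version serves all levels at once. -/
def condCoverage (μ : Measure Ω) [IsFiniteMeasure μ] (A : Algorithm) {p n : ℕ}
    (Z : Fin (n + 1) → Ω → Obs p) (α₁ α₂ δ : ℝ) (ω : Ω) : ℝ :=
  (condDistrib (newObs Z) (train Z) μ (train Z ω)).real
    {z : Obs p | z.1 ∈ predInterval A (train Z ω) z.2 α₁ α₂ δ}

end Random

/-- The pairs of levels `(α₁, α₂)` with `0 ≤ α₁ ≤ α₂ ≤ 1`. -/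
def levels : Set (ℝ × ℝ) := {a | 0 ≤ a.1 ∧ a.1 ≤ a.2 ∧ a.2 ≤ 1}

section Sequences

variable {Ω : ℕ → Type*} [∀ n, MeasurableSpace (Ω n)]

/-- Stochastic boundedness of a sequence of random variables, indexed by the sample sizes
`n ≥ 2`, the `n`-th one on the `n`-th probability space. -/
def StochBounded (μ : ∀ n, Measure (Ω n)) (X : ∀ n, Ω n → ℝ≥0∞) : Prop :=
  ∀ ε : ℝ≥0∞, 0 < ε → ∃ K : ℝ≥0, ∀ n, 2 ≤ n → μ n {ω | (K : ℝ≥0∞) < X n ω} ≤ ε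

/-- Asymptotic out-of-sample stability. -/
def Stable (μ : ∀ n, Measure (Ω n)) (A : Algorithm) {p : ℕ → ℕ}
    (Z : ∀ n, Fin (n + 1) → Ω n → Obs (p n)) : Prop :=
  ∀ ε : ℝ, 0 < ε →
    Tendsto (fun n : ℕ => (1 / (n : ℝ)) *
      ∑ i : Fin n, (μ n).real {ω | ε ≤ |yHat A (Z n) ω - yHatLoo A (Z n) i ω|}) atTop (𝓝 0)

end Sequences

/-- The conditional distribution of the response given the feature vector under the law `P`. -/
def condLaw {p : ℕ} (P : Measure (Obs p)) [IsFiniteMeasure P] (x : Fin p → ℝ) : Measure ℝ :=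
  condDistrib Prod.fst Prod.snd P x

/-- The supremum norm of the Lebesgue density of `ν`. A density is determined only almost
everywhere; the essential supremum is the smallest supremum over its versions. -/
def densitySup (ν : Measure ℝ) : ℝ≥0∞ := essSup (ν.rnDeriv volume) volume

/-- The continuous case assumption on the laws `P n`, `n ≥ 2`. -/
structure ContinuousCase {p : ℕ → ℕ} (P : ∀ n, Measure (Obs (p n)))
    [∀ n, IsProbabilityMeasure (P n)] : Prop where
  /-- Almost surely, the response given the features has a bounded density. -/
  density : ∀ n, 2 ≤ n → ∀ᵐ x ∂((P n).map Prod.snd),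
    condLaw (P n) x ≪ volume ∧ densitySup (condLaw (P n) x) < ⊤
  /-- The supremum norms of the conditional densities are stochastically bounded. -/
  bounded : StochBounded (fun n => (P n).map Prod.snd) (fun n x => densitySup (condLaw (P n) x))

end Jackknife

end

/-!
The statement reduces to one comparison: off an event of small probability about the training data
`T`, the conditional distribution function of the prediction error `y - ŷ` given `T` and the
empirical distribution function of the leave-one-out residuals agree up to a shift by `d` and an
error `ε`, for arbitrarily small `d` and `ε` (`eventually_exists_bad_set_shiftClose`).

The comparison rests on a second moment bound that needs no symmetry of the algorithm
(`integral_sq_average_loo_sub_mean_le`). For a `[0, 1]`-valued Lipschitz function `φ`, let `Φ(T)` be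
the conditional mean of `φ(y - ŷ)`. The variables `φ(û_i) - Φ(T)` are almost uncorrelated: two
further observations are added to the sample, the `i`-th and `j`-th training observations are
exchanged with them, and stability allows the `i`-th and `j`-th training observations to be replaced
one after the other, since each replacement passes through a leave-one-out predictor evaluated at an
observation outside its training sample. Only stability at sample size `n` enters, because a
predictor trained on `n - 1` observations is always compared with one trained on `n`. So the average
of `φ(û_i)` is close to `Φ(T)` in mean square. Applied to finitely many piecewise linear cutoffs
`φ`, with stochastic boundedness of the prediction error controlling the tails, this gives the
comparison of the distribution functions (`exists_bad_set_shiftClose`).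

Given the comparison, coverage is deterministic: widening or narrowing the half-line below the
`α`-quantile by `δ ≥ 3 d` gives mass at least `α - ε` or at most `α + ε`
(`ShiftClose.quantileBounds`), for all levels at once. In the continuous case an interval of length
`δ` has small error probability whatever the training data (`errorLaw_Icc_le`), so the distortion
can be removed (`QuantileBounds.zero_of_modulus`). Integrability of the supremum over the levels
follows from its reduction to rational levels, as the empirical quantiles are left-continuous step
functions of the level (`measurable_supDeviation`).
-/

namespace Jackknife

/-! ### Exchangeability and a second moment bound -/

section SecondMoment

variable {ι E : Type*} [MeasurableSpace E]

theorem integrable_of_measurable_of_abs_le {S : Type*} [MeasurableSpace S] {m : Measure S}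
    [IsFiniteMeasure m] {f : S → ℝ} (hf : Measurable f) {C : ℝ} (hC : ∀ s, |f s| ≤ C) :
    Integrable f m :=
  Integrable.of_bound hf.aestronglyMeasurable C (ae_of_all _ hC)

theorem abs_sub_le_one {a b : ℝ} (ha : a ∈ Set.Icc (0 : ℝ) 1) (hb : b ∈ Set.Icc (0 : ℝ) 1) :
    |a - b| ≤ 1 := by
  rw [abs_le]; constructor <;> linarith [ha.1, ha.2, hb.1, hb.2]

theorem abs_mul_sub_mul_le {a b c d : ℝ} (ha : a ∈ Set.Icc (0 : ℝ) 1)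
    (hd : d ∈ Set.Icc (0 : ℝ) 1) : |a * b - c * d| ≤ |a - c| + |b - d| := by
  have h : a * b - c * d = (a - c) * d + a * (b - d) := by ring
  rw [h]
  refine (abs_add_le _ _).trans ?_
  rw [abs_mul, abs_mul, abs_of_nonneg ha.1, abs_of_nonneg hd.1]
  gcongr
  · exact mul_le_of_le_one_right (abs_nonneg _) hd.2
  · exact mul_le_of_le_one_left (abs_nonneg _) ha.2

theorem integral_abs_sub_triangle {S : Type*} [MeasurableSpace S] {m : Measure S}
    [IsFiniteMeasure m] {f g k : S → ℝ} (hf : Measurable f) (hg : Measurable g) (hk : Measurable k)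
    (hf1 : ∀ s, f s ∈ Set.Icc (0 : ℝ) 1) (hg1 : ∀ s, g s ∈ Set.Icc (0 : ℝ) 1)
    (hk1 : ∀ s, k s ∈ Set.Icc (0 : ℝ) 1) :
    ∫ s, |f s - k s| ∂m ≤ ∫ s, |f s - g s| ∂m + ∫ s, |g s - k s| ∂m := by
  have i1 : Integrable (fun s => |f s - g s|) m :=
    (integrable_of_measurable_of_abs_le (hf.sub hg) fun s => abs_sub_le_one (hf1 s) (hg1 s)).abs
  have i2 : Integrable (fun s => |g s - k s|) m :=
    (integrable_of_measurable_of_abs_le (hg.sub hk) fun s => abs_sub_le_one (hg1 s) (hk1 s)).abs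
  have i3 : Integrable (fun s => |f s - k s|) m :=
    (integrable_of_measurable_of_abs_le (hf.sub hk) fun s => abs_sub_le_one (hf1 s) (hk1 s)).abs
  rw [← integral_add i1 i2]
  exact integral_mono i3 (i1.add i2) fun s => abs_sub_le _ _ _

theorem abs_integral_mul_sub_integral_mul_le {S : Type*} [MeasurableSpace S] {m : Measure S}
    [IsFiniteMeasure m] {a b c d : S → ℝ} (ha : Measurable a) (hb : Measurable b)
    (hc : Measurable c) (hd : Measurable d)
    (ha1 : ∀ s, a s ∈ Set.Icc (0 : ℝ) 1) (hb1 : ∀ s, b s ∈ Set.Icc (0 : ℝ) 1)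
    (hc1 : ∀ s, c s ∈ Set.Icc (0 : ℝ) 1) (hd1 : ∀ s, d s ∈ Set.Icc (0 : ℝ) 1) :
    |∫ s, a s * b s ∂m - ∫ s, c s * d s ∂m|
      ≤ ∫ s, |a s - c s| ∂m + ∫ s, |b s - d s| ∂m := by
  have hm : ∀ {u v : ℝ}, u ∈ Set.Icc (0 : ℝ) 1 → v ∈ Set.Icc (0 : ℝ) 1 → |u * v| ≤ 1 := by
    intro u v hu hv
    rw [abs_of_nonneg (mul_nonneg hu.1 hv.1)]
    exact mul_le_one₀ hu.2 hv.1 hv.2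
  have i1 : Integrable (fun s => a s * b s) m :=
    integrable_of_measurable_of_abs_le (ha.mul hb) fun s => hm (ha1 s) (hb1 s)
  have i2 : Integrable (fun s => c s * d s) m :=
    integrable_of_measurable_of_abs_le (hc.mul hd) fun s => hm (hc1 s) (hd1 s)
  have j1 : Integrable (fun s => |a s - c s|) m :=
    (integrable_of_measurable_of_abs_le (ha.sub hc) fun s => abs_sub_le_one (ha1 s) (hc1 s)).abs
  have j2 : Integrable (fun s => |b s - d s|) m :=
    (integrable_of_measurable_of_abs_le (hb.sub hd) fun s => abs_sub_le_one (hb1 s) (hd1 s)).abs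
  rw [← integral_sub i1 i2, ← integral_add j1 j2]
  refine (abs_integral_le_integral_abs).trans ?_
  exact integral_mono (i1.sub i2).abs (j1.add j2) fun s => abs_mul_sub_mul_le (ha1 s) (hd1 s)

/-- Relabelling i.i.d. coordinates injectively does not change their joint law. -/
theorem measurePreserving_pi_comp_injective {κ : Type*} [Fintype ι] [Fintype κ] (P : Measure E)
    [IsProbabilityMeasure P] {f : ι → κ} (hf : Function.Injective f) :
    MeasurePreserving (fun (X : κ → E) i => X (f i)) (Measure.pi fun _ => P)
      (Measure.pi fun _ => P) := by
  refine ⟨by fun_prop, ?_⟩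
  have h : iIndepFun (fun (k : κ) (X : κ → E) => X k) (Measure.pi fun _ => P) :=
    iIndepFun_pi (X := fun _ => id) (fun _ => aemeasurable_id)
  have h2 := h.precomp hf
  rw [iIndepFun_iff_map_fun_eq_pi_map (fun i => (measurable_pi_apply _).aemeasurable)] at h2
  rw [h2]
  congr 1
  funext i
  exact (measurePreserving_eval (fun _ => P) (f i)).map_eq

/-- Out of a sample indexed by `ι ⊕ Fin 2`, the training sample together with the `k`-th of the two
test observations. -/
def testPair (k : Fin 2) (X : ι ⊕ Fin 2 → E) : (ι → E) × E :=
  (fun i => X (Sum.inl i), X (Sum.inr k))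

theorem measurable_testPair (k : Fin 2) : Measurable (testPair (ι := ι) (E := E) k) := by
  unfold testPair; fun_prop

variable [Fintype ι] (P : Measure E) [IsProbabilityMeasure P]

theorem measurePreserving_testPair (k : Fin 2) :
    MeasurePreserving (testPair (ι := ι) (E := E) k) (Measure.pi fun _ => P)
      ((Measure.pi fun _ => P).prod P) := by
  have h1 := measurePreserving_sumPiEquivProdPi (fun _ : ι ⊕ Fin 2 => P)
  have h2 : MeasurePreserving (Prod.map id (Function.eval k) : (ι → E) × (Fin 2 → E) → _)
      ((Measure.pi fun _ => P).prod (Measure.pi fun _ => P)) ((Measure.pi fun _ => P).prod P) :=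
    (MeasurePreserving.id _).prod (measurePreserving_eval (fun _ => P) k)
  exact h2.comp h1

theorem measurePreserving_testPair_perm (k : Fin 2) (σ : Equiv.Perm (ι ⊕ Fin 2)) :
    MeasurePreserving (fun X : ι ⊕ Fin 2 → E => testPair k (X ∘ σ)) (Measure.pi fun _ => P)
      ((Measure.pi fun _ => P).prod P) :=
  (measurePreserving_testPair P k).comp (measurePreserving_pi_comp_injective P σ.injective)

variable {P}
variable {h : (ι → E) × E → ℝ}

theorem integral_testPair_perm (k : Fin 2) (σ : Equiv.Perm (ι ⊕ Fin 2)) {F : (ι → E) × E → ℝ}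
    (hF : Measurable F) :
    ∫ X, F (testPair k (X ∘ σ)) ∂(Measure.pi fun _ : ι ⊕ Fin 2 => P)
      = ∫ q, F q ∂((Measure.pi fun _ => P).prod P) := by
  have hp := measurePreserving_testPair_perm P k σ
  rw [← hp.map_eq, integral_map hp.measurable.aemeasurable hF.aestronglyMeasurable]

theorem integral_testPair_mul (hh : Measurable h) (hh1 : ∀ q, h q ∈ Set.Icc (0 : ℝ) 1)
    {G : (ι → E) → ℝ} (hG : Measurable G) (hG1 : ∀ T, G T ∈ Set.Icc (0 : ℝ) 1) :
    ∫ X, G (fun i => X (Sum.inl i)) * h (testPair 1 X) ∂(Measure.pi fun _ : ι ⊕ Fin 2 => P)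
      = ∫ T, G T * ∫ z, h (T, z) ∂P ∂(Measure.pi fun _ => P) := by
  have hp := measurePreserving_testPair (ι := ι) P 1
  have hm : Measurable fun q : (ι → E) × E => G q.1 * h q := by fun_prop
  have e1 : ∫ X, G (fun i => X (Sum.inl i)) * h (testPair 1 X)
      ∂(Measure.pi fun _ : ι ⊕ Fin 2 => P)
      = ∫ q, G q.1 * h q ∂((Measure.pi fun _ => P).prod P) := by
    rw [← hp.map_eq, integral_map hp.measurable.aemeasurable hm.aestronglyMeasurable]
    rfl
  rw [e1, integral_prod]
  · simp_rw [integral_const_mul]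
  · refine integrable_of_measurable_of_abs_le hm (C := 1) fun q => ?_
    rw [abs_of_nonneg (mul_nonneg (hG1 _).1 (hh1 _).1)]
    exact mul_le_one₀ (hG1 _).2 (hh1 _).1 (hh1 _).2

/-- Given the training sample the two test observations are independent, so the squared conditional
mean becomes an integral of a product. -/
theorem integral_testPair_mul_testPair (hh : Measurable h)
    (hh1 : ∀ q, h q ∈ Set.Icc (0 : ℝ) 1) :
    ∫ X, h (testPair 0 X) * h (testPair 1 X) ∂(Measure.pi fun _ : ι ⊕ Fin 2 => P)
      = ∫ T, (∫ z, h (T, z) ∂P) * ∫ z, h (T, z) ∂P ∂(Measure.pi fun _ => P) := by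
  have h1 := measurePreserving_sumPiEquivProdPi (fun _ : ι ⊕ Fin 2 => P)
  have h2 : MeasurePreserving (Prod.map id (MeasurableEquiv.piFinTwo fun _ => E) :
        (ι → E) × (Fin 2 → E) → _)
      ((Measure.pi fun _ => P).prod (Measure.pi fun _ => P))
      ((Measure.pi fun _ => P).prod (P.prod P)) :=
    (MeasurePreserving.id _).prod (measurePreserving_piFinTwo (fun _ => P))
  have hp := h2.comp h1
  have hm : Measurable fun q : (ι → E) × (E × E) => h (q.1, q.2.1) * h (q.1, q.2.2) := by fun_prop
  have e1 : ∫ X, h (testPair 0 X) * h (testPair 1 X) ∂(Measure.pi fun _ : ι ⊕ Fin 2 => P)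
      = ∫ q, h (q.1, q.2.1) * h (q.1, q.2.2) ∂((Measure.pi fun _ => P).prod (P.prod P)) := by
    rw [← hp.map_eq, integral_map hp.measurable.aemeasurable hm.aestronglyMeasurable]
    rfl
  rw [e1, integral_prod]
  · refine integral_congr_ae (ae_of_all _ fun T => ?_)
    exact integral_prod_mul (fun z => h (T, z)) fun z => h (T, z)
  · refine integrable_of_measurable_of_abs_le hm (C := 1) fun q => ?_
    rw [abs_of_nonneg (mul_nonneg (hh1 _).1 (hh1 _).1)]
    exact mul_le_one₀ (hh1 _).2 (hh1 _).1 (hh1 _).2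

theorem integral_swap_mul_swap (hh : Measurable h) (hh1 : ∀ q, h q ∈ Set.Icc (0 : ℝ) 1)
    (σ : Equiv.Perm (ι ⊕ Fin 2)) :
    ∫ X, h (testPair 0 (X ∘ σ)) * h (testPair 1 (X ∘ σ)) ∂(Measure.pi fun _ : ι ⊕ Fin 2 => P)
      = ∫ T, (∫ z, h (T, z) ∂P) * ∫ z, h (T, z) ∂P ∂(Measure.pi fun _ => P) := by
  rw [← integral_testPair_mul_testPair hh hh1]
  have hp := measurePreserving_pi_comp_injective P σ.injective
  have hm : Measurable fun X : ι ⊕ Fin 2 → E => h (testPair 0 X) * h (testPair 1 X) :=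
    (hh.comp (measurable_testPair 0)).mul (hh.comp (measurable_testPair 1))
  conv_rhs => rw [← hp.map_eq, integral_map hp.measurable.aemeasurable hm.aestronglyMeasurable]
  rfl

end SecondMoment

section AveragedResiduals

/-- A function that ignores the `i`-th training observation cannot tell apart two samples that
differ only there. -/
theorem testPair_congr {ι E : Type*} [DecidableEq ι] {k : Fin 2} {i : ι} {g : (ι → E) × E → ℝ}
    (hg : ∀ T w z, g (Function.update T i w, z) = g (T, z)) {X Y : ι ⊕ Fin 2 → E}
    (hXY : ∀ j, j ≠ i → X (Sum.inl j) = Y (Sum.inl j)) (hk : X (Sum.inr k) = Y (Sum.inr k)) :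
    g (testPair k X) = g (testPair k Y) := by
  have : testPair k X = (Function.update (testPair k Y).1 i (X (Sum.inl i)), (testPair k Y).2) := by
    refine Prod.ext ?_ hk
    funext j
    by_cases hj : j = i
    · subst hj; simp [testPair]
    · simp [testPair, hj, hXY j hj]
  rw [this, hg]

variable {ι E : Type*} [MeasurableSpace E] [Fintype ι] [DecidableEq ι] {P : Measure E}
  [IsProbabilityMeasure P] {h : (ι → E) × E → ℝ} {g : ι → (ι → E) × E → ℝ}

/-- The exchange of the `i`-th training observation with the `k`-th test observation. -/
abbrev swapTest (i : ι) (k : Fin 2) : Equiv.Perm (ι ⊕ Fin 2) :=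
  Equiv.swap (Sum.inl i) (Sum.inr k)

/-- The leave-one-out value at the `i`-th training observation is close in mean to the full-sample
value at that observation after it has been replaced, in the training sample, by a test
observation. -/
theorem integral_abs_loo_sub_swap (hh : Measurable h) (hg : ∀ i, Measurable (g i))
    (hgi : ∀ i T w z, g i (Function.update T i w, z) = g i (T, z)) (k : Fin 2) (i : ι) :
    ∫ X, |g i (fun j => X (Sum.inl j), X (Sum.inl i)) - h (testPair k (X ∘ swapTest i k))|
        ∂(Measure.pi fun _ : ι ⊕ Fin 2 => P)
      = ∫ q, |h q - g i q| ∂((Measure.pi fun _ => P).prod P) := by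
  have hm : Measurable fun q => |h q - g i q| := (hh.sub (hg i)).abs
  rw [← integral_testPair_perm k (swapTest i k) hm]
  refine integral_congr_ae (ae_of_all _ fun X => ?_)
  have e : g i (fun j => X (Sum.inl j), X (Sum.inl i)) = g i (testPair k (X ∘ swapTest i k)) := by
    have e2 : testPair k (X ∘ swapTest i k)
        = (Function.update (fun j => X (Sum.inl j)) i (X (Sum.inr k)), X (Sum.inl i)) := by
      refine Prod.ext ?_ (by simp [testPair])
      funext j
      by_cases hj : j = i
      · subst hj; simp [testPair]
      · simp [testPair, hj, Equiv.swap_apply_of_ne_of_ne]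
    rw [e2, hgi]
  simp only [e, abs_sub_comm]

/-- Full-sample values at the same test observation are close in mean if the training samples differ
only in the `j`-th observation: both are close to the leave-one-out value. -/
theorem integral_abs_swap_sub_swap_le (hh : Measurable h) (hg : ∀ i, Measurable (g i))
    (hh1 : ∀ q, h q ∈ Set.Icc (0 : ℝ) 1) (hg1 : ∀ i q, g i q ∈ Set.Icc (0 : ℝ) 1)
    (hgi : ∀ i T w z, g i (Function.update T i w, z) = g i (T, z)) (k : Fin 2) (j : ι)
    (σ τ : Equiv.Perm (ι ⊕ Fin 2)) (hστ : ∀ l, l ≠ j → σ (Sum.inl l) = τ (Sum.inl l))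
    (hk : σ (Sum.inr k) = τ (Sum.inr k)) :
    ∫ X, |h (testPair k (X ∘ σ)) - h (testPair k (X ∘ τ))|
        ∂(Measure.pi fun _ : ι ⊕ Fin 2 => P)
      ≤ 2 * ∫ q, |h q - g j q| ∂((Measure.pi fun _ => P).prod P) := by
  have hm : Measurable fun q => |h q - g j q| := (hh.sub (hg j)).abs
  have mσ := (measurePreserving_testPair_perm P k σ).measurable
  have mτ := (measurePreserving_testPair_perm P k τ).measurable
  refine (integral_abs_sub_triangle (g := fun X => g j (testPair k (X ∘ σ))) (hh.comp mσ)
    ((hg j).comp mσ) (hh.comp mτ) (fun _ => hh1 _) (fun _ => hg1 _ _) (fun _ => hh1 _)).trans ?_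
  rw [two_mul]
  refine add_le_add (integral_testPair_perm k σ hm).le ?_
  rw [← integral_testPair_perm k τ hm]
  refine (integral_congr_ae (ae_of_all _ fun X => ?_)).le
  have e : g j (testPair k (X ∘ σ)) = g j (testPair k (X ∘ τ)) :=
    testPair_congr (hgi j) (fun l hl => by simp [hστ l hl]) (by simp [hk])
  simp only [e, Function.comp_apply]
  exact abs_sub_comm _ _

/-- The product of a leave-one-out value and the conditional mean has almost the mean of the squared
conditional mean. -/
theorem abs_integral_loo_mul_mean_sub_le (hh : Measurable h) (hg : ∀ i, Measurable (g i))
    (hh1 : ∀ q, h q ∈ Set.Icc (0 : ℝ) 1) (hg1 : ∀ i q, g i q ∈ Set.Icc (0 : ℝ) 1)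
    (hgi : ∀ i T w z, g i (Function.update T i w, z) = g i (T, z)) (i : ι) :
    |∫ T, g i (T, T i) * ∫ z, h (T, z) ∂P ∂(Measure.pi fun _ => P)
        - ∫ T, (∫ z, h (T, z) ∂P) * ∫ z, h (T, z) ∂P ∂(Measure.pi fun _ => P)|
      ≤ 3 * ∫ q, |h q - g i q| ∂((Measure.pi fun _ => P).prod P) := by
  have m (k : Fin 2) (σ : Equiv.Perm (ι ⊕ Fin 2)) :=
    (measurePreserving_testPair_perm P k σ).measurable
  have hG : Measurable fun T : ι → E => g i (T, T i) := (hg i).comp (by fun_prop)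
  have hGX : Measurable fun X : ι ⊕ Fin 2 → E => g i (fun j => X (Sum.inl j), X (Sum.inl i)) :=
    (hg i).comp (by fun_prop)
  rw [← integral_testPair_mul hh hh1 hG (fun _ => hg1 _ _),
    ← integral_swap_mul_swap hh hh1 (swapTest i 0)]
  refine (abs_integral_mul_sub_integral_mul_le hGX (hh.comp (measurable_testPair 1))
    (hh.comp (m 0 _)) (hh.comp (m 1 _)) (fun _ => hg1 _ _) (fun _ => hh1 _)
    (fun _ => hh1 _) (fun _ => hh1 _)).trans ?_
  have h1 := integral_abs_loo_sub_swap (P := P) hh hg hgi 0 i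
  have h2 := integral_abs_swap_sub_swap_le (P := P) hh hg hh1 hg1 hgi 1 i (Equiv.refl _)
    (swapTest i 0) (fun l hl => by simp [hl, Equiv.swap_apply_of_ne_of_ne])
    (by simp [Equiv.swap_apply_of_ne_of_ne])
  simp only [Equiv.coe_refl, Function.comp_id] at h2
  simp only [Function.comp_apply]
  linarith

/-- The product of leave-one-out values at different observations also has almost the mean of the
squared conditional mean: after both observations have been replaced in the training sample, they
act as two fresh test observations. -/
theorem abs_integral_loo_mul_loo_sub_le (hh : Measurable h) (hg : ∀ i, Measurable (g i))
    (hh1 : ∀ q, h q ∈ Set.Icc (0 : ℝ) 1) (hg1 : ∀ i q, g i q ∈ Set.Icc (0 : ℝ) 1)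
    (hgi : ∀ i T w z, g i (Function.update T i w, z) = g i (T, z)) {i j : ι} (hij : i ≠ j) :
    |∫ T, g i (T, T i) * g j (T, T j) ∂(Measure.pi fun _ => P)
        - ∫ T, (∫ z, h (T, z) ∂P) * ∫ z, h (T, z) ∂P ∂(Measure.pi fun _ => P)|
      ≤ 3 * (∫ q, |h q - g i q| ∂((Measure.pi fun _ => P).prod P)
        + ∫ q, |h q - g j q| ∂((Measure.pi fun _ => P).prod P)) := by
  have m (k : Fin 2) (σ : Equiv.Perm (ι ⊕ Fin 2)) :=
    (measurePreserving_testPair_perm P k σ).measurable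
  have hG (i : ι) : Measurable fun T : ι → E => g i (T, T i) := (hg i).comp (by fun_prop)
  have hGX (i : ι) :
      Measurable fun X : ι ⊕ Fin 2 → E => g i (fun j => X (Sum.inl j), X (Sum.inl i)) :=
    (hg i).comp (by fun_prop)
  have e1 : ∫ T, g i (T, T i) * g j (T, T j) ∂(Measure.pi fun _ => P)
      = ∫ X, g i (fun l => X (Sum.inl l), X (Sum.inl i)) *
          g j (fun l => X (Sum.inl l), X (Sum.inl j)) ∂(Measure.pi fun _ : ι ⊕ Fin 2 => P) := by
    have hp : MeasurePreserving (fun (X : ι ⊕ Fin 2 → E) i => X (Sum.inl i))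
      (Measure.pi fun _ => P) (Measure.pi fun _ => P) :=
      measurePreserving_pi_comp_injective P Sum.inl_injective
    have hm : Measurable fun T : ι → E => g i (T, T i) * g j (T, T j) := (hG i).mul (hG j)
    rw [← hp.map_eq, integral_map hp.measurable.aemeasurable hm.aestronglyMeasurable]
  let τ : Equiv.Perm (ι ⊕ Fin 2) := swapTest i 0 * swapTest j 1
  rw [e1, ← integral_swap_mul_swap hh hh1 τ]
  refine (abs_integral_mul_sub_integral_mul_le (hGX i) (hGX j)
    (hh.comp (m 0 _)) (hh.comp (m 1 _)) (fun _ => hg1 _ _) (fun _ => hg1 _ _)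
    (fun _ => hh1 _) (fun _ => hh1 _)).trans ?_
  have a1 := integral_abs_loo_sub_swap (P := P) hh hg hgi 0 i
  have a2 := integral_abs_swap_sub_swap_le (P := P) hh hg hh1 hg1 hgi 0 j (swapTest i 0) τ
    (fun l hl => by simp [τ, Equiv.swap_apply_of_ne_of_ne, hl])
    (by simp [τ, Equiv.swap_apply_of_ne_of_ne])
  have b1 := integral_abs_loo_sub_swap (P := P) hh hg hgi 1 j
  have b2 := integral_abs_swap_sub_swap_le (P := P) hh hg hh1 hg1 hgi 1 i (swapTest j 1) τ
    (fun l hl => by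
      by_cases hlj : l = j
      · subst hlj; simp [τ, Equiv.swap_apply_of_ne_of_ne]
      · simp [τ, Equiv.swap_apply_of_ne_of_ne, hl, hlj])
    (by simp [τ, Equiv.swap_apply_of_ne_of_ne, hij.symm])
  have a3 := integral_abs_sub_triangle (m := Measure.pi fun _ : ι ⊕ Fin 2 => P)
    (hGX i) (hh.comp (m 0 (swapTest i 0))) (hh.comp (m 0 τ))
    (fun _ => hg1 _ _) (fun _ => hh1 _) (fun _ => hh1 _)
  have b3 := integral_abs_sub_triangle (m := Measure.pi fun _ : ι ⊕ Fin 2 => P)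
    (hGX j) (hh.comp (m 1 (swapTest j 1))) (hh.comp (m 1 τ))
    (fun _ => hg1 _ _) (fun _ => hh1 _) (fun _ => hh1 _)
  simp only [Function.comp_apply] at a3 b3 ⊢
  linarith

/-- The mean square distance of the average of the leave-one-out values from the conditional mean
of the full-sample value is controlled by the average instability. -/
theorem integral_sq_average_loo_sub_mean_le {n : ℕ} (hn : 0 < n) {P : Measure E}
    [IsProbabilityMeasure P] {h : (Fin n → E) × E → ℝ} {g : Fin n → (Fin n → E) × E → ℝ}
    (hh : Measurable h) (hg : ∀ i, Measurable (g i))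
    (hh1 : ∀ q, h q ∈ Set.Icc (0 : ℝ) 1) (hg1 : ∀ i q, g i q ∈ Set.Icc (0 : ℝ) 1)
    (hgi : ∀ i T w z, g i (Function.update T i w, z) = g i (T, z)) :
    ∫ T, ((1 / (n : ℝ)) * ∑ i, g i (T, T i) - ∫ z, h (T, z) ∂P) ^ 2 ∂(Measure.pi fun _ => P)
      ≤ 1 / (n : ℝ) + 12 * ((1 / (n : ℝ)) *
        ∑ i, ∫ q, |h q - g i q| ∂((Measure.pi fun _ => P).prod P)) := by
  set D : Fin n → ℝ := fun i => ∫ q, |h q - g i q| ∂((Measure.pi fun _ => P).prod P) with hD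
  let Φ : (Fin n → E) → ℝ := fun T => ∫ z, h (T, z) ∂P
  have hD0 : ∀ i, 0 ≤ D i := fun i => integral_nonneg fun _ => abs_nonneg _
  have hn' : (0 : ℝ) < n := by exact_mod_cast hn
  have hΦm : Measurable Φ := (hh.stronglyMeasurable.integral_prod_right' (ν := P)).measurable
  have hΦ1 : ∀ T, Φ T ∈ Set.Icc (0 : ℝ) 1 := fun T => by
    refine ⟨integral_nonneg fun z => (hh1 _).1, ?_⟩
    have := integral_mono (μ := P) (f := fun z => h (T, z)) (g := fun _ => (1 : ℝ))
      (integrable_of_measurable_of_abs_le (C := 1) (hh.comp (by fun_prop)) fun z => by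
        rw [abs_of_nonneg (hh1 _).1]; exact (hh1 _).2) (integrable_const _)
      (fun z => (hh1 _).2)
    simpa using this
  have hG (i : Fin n) : Measurable fun T : Fin n → E => g i (T, T i) := (hg i).comp (by fun_prop)
  have int2 : ∀ {u v : (Fin n → E) → ℝ}, Measurable u → Measurable v →
      (∀ T, u T ∈ Set.Icc (0 : ℝ) 1) → (∀ T, v T ∈ Set.Icc (0 : ℝ) 1) →
      Integrable (fun T => u T * v T) (Measure.pi fun _ => P) := by
    intro u v hu hv hu1 hv1
    refine integrable_of_measurable_of_abs_le (hu.mul hv) (C := 1) fun T => ?_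
    rw [abs_of_nonneg (mul_nonneg (hu1 _).1 (hv1 _).1)]
    exact mul_le_one₀ (hu1 _).2 (hv1 _).1 (hv1 _).2
  have iG (i j : Fin n) := int2 (hG i) (hG j) (fun _ => hg1 _ _) (fun _ => hg1 _ _)
  have iGΦ (i : Fin n) := int2 (hG i) hΦm (fun _ => hg1 _ _) hΦ1
  have iΦ := int2 hΦm hΦm hΦ1 hΦ1
  have hprod : ∀ (i j : Fin n) (T : Fin n → E),
      (g i (T, T i) - Φ T) * (g j (T, T j) - Φ T)
        = g i (T, T i) * g j (T, T j) - g i (T, T i) * Φ T - (g j (T, T j) * Φ T - Φ T * Φ T) :=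
    fun i j T => by ring
  have iP : ∀ i j : Fin n, Integrable (fun T => (g i (T, T i) - Φ T) * (g j (T, T j) - Φ T))
      (Measure.pi fun _ => P) := fun i j => by
    simp_rw [hprod]
    exact ((iG i j).sub (iGΦ i)).sub ((iGΦ j).sub iΦ)
  have hpair : ∀ i j : Fin n, ∫ T, (g i (T, T i) - Φ T) * (g j (T, T j) - Φ T)
      ∂(Measure.pi fun _ => P) ≤ (if i = j then 1 else 0) + 6 * (D i + D j) := by
    intro i j
    by_cases hij : i = j
    · subst hij
      rw [if_pos rfl]
      have : ∫ T, (g i (T, T i) - Φ T) * (g i (T, T i) - Φ T) ∂(Measure.pi fun _ => P)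
          ≤ ∫ T : Fin n → E, (1 : ℝ) ∂(Measure.pi fun _ => P) := by
        refine integral_mono (iP i i) (integrable_const _) fun T => ?_
        have := abs_le.1 (abs_sub_le_one (hg1 i (T, T i)) (hΦ1 T))
        nlinarith [this.1, this.2]
      simp only [integral_const, probReal_univ, smul_eq_mul, mul_one] at this
      linarith [hD0 i]
    · rw [if_neg hij]
      simp_rw [hprod]
      have s1 := integral_sub ((iG i j).sub (iGΦ i)) ((iGΦ j).sub iΦ)
      simp only [Pi.sub_apply] at s1
      rw [s1, integral_sub (iG i j) (iGΦ i), integral_sub (iGΦ j) iΦ]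
      have c1 := abs_le.1 (abs_integral_loo_mul_loo_sub_le (P := P) hh hg hh1 hg1 hgi hij)
      have c2 := abs_le.1 (abs_integral_loo_mul_mean_sub_le (P := P) hh hg hh1 hg1 hgi i)
      have c3 := abs_le.1 (abs_integral_loo_mul_mean_sub_le (P := P) hh hg hh1 hg1 hgi j)
      simp only [hD]
      linarith [c1.2, c2.1, c3.1]
  have hsq : ∀ T : Fin n → E, ((1 / (n : ℝ)) * ∑ i, g i (T, T i) - Φ T) ^ 2
      = (1 / (n : ℝ)) ^ 2 * ∑ i, ∑ j, (g i (T, T i) - Φ T) * (g j (T, T j) - Φ T) := by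
    intro T
    rw [← Finset.sum_mul_sum, Finset.sum_sub_distrib]
    simp only [Finset.sum_const, Finset.card_univ, Fintype.card_fin, nsmul_eq_mul]
    field_simp
  rw [integral_congr_ae (ae_of_all _ hsq), integral_const_mul,
    integral_finsetSum _ fun i _ => integrable_finsetSum _ fun j _ => iP i j]
  rw [Finset.sum_congr rfl fun i _ => integral_finsetSum Finset.univ fun j _ => iP i j]
  have hsum : ∑ i, ∑ j, ∫ T, (g i (T, T i) - Φ T) * (g j (T, T j) - Φ T) ∂(Measure.pi fun _ => P)
      ≤ n + 12 * n * ∑ i, D i := by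
    refine (Finset.sum_le_sum fun i _ => Finset.sum_le_sum fun j _ => hpair i j).trans_eq ?_
    simp only [Finset.sum_add_distrib, ← Finset.mul_sum, Finset.sum_ite_eq, Finset.mem_univ,
      if_true, Finset.sum_const, Finset.card_univ, Fintype.card_fin, nsmul_eq_mul]
    ring
  refine (mul_le_mul_of_nonneg_left hsum (by positivity)).trans_eq ?_
  field_simp

end AveragedResiduals

/-! ### Distribution functions that are close up to a shift, and their quantiles -/

/-- It suffices to compare two distribution functions on a finite grid, if the grid exhausts the
mass of one of them. -/
theorem shift_close_of_grid {G H : ℝ → ℝ} (hG : Monotone G) (hH : Monotone H)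
    (hG1 : ∀ t, G t ∈ Set.Icc (0 : ℝ) 1) (hH1 : ∀ t, H t ∈ Set.Icc (0 : ℝ) 1)
    {a d ε : ℝ} (hd : 0 < d) (hε : 0 ≤ ε) (N : ℕ)
    (h1 : ∀ k : ℕ, k ≤ N + 1 → G (a + k * d) ≤ H (a + k * d + d) + ε)
    (h2 : ∀ k : ℕ, k ≤ N + 1 → H (a + k * d) ≤ G (a + k * d + d) + ε)
    (hlo : H (a + d) ≤ ε) (hhi : 1 - ε ≤ H (a + N * d)) (t : ℝ) :
    H t ≤ G (t + 2 * d) + 2 * ε ∧ G t ≤ H (t + 2 * d) + 2 * ε := by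
  rcases lt_or_ge t a with hta | hta
  · have e1 := h1 0 (by omega)
    simp only [Nat.cast_zero, zero_mul, add_zero] at e1
    have e2 : H t ≤ H (a + d) := hH (by linarith)
    have e3 : G t ≤ G a := hG hta.le
    constructor
    · linarith [(hG1 (t + 2 * d)).1]
    · linarith [(hH1 (t + 2 * d)).1]
  · obtain ⟨k, hk1, hk2⟩ : ∃ k : ℕ, a + k * d ≤ t ∧ t < a + k * d + d := by
      have h0 : 0 ≤ (t - a) / d := div_nonneg (by linarith) hd.le
      refine ⟨⌊(t - a) / d⌋₊, ?_, ?_⟩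
      · have := (le_div_iff₀ hd).1 (Nat.floor_le h0)
        linarith
      · have := (div_lt_iff₀ hd).1 (Nat.lt_floor_add_one ((t - a) / d))
        linarith
    rcases le_or_gt k N with hkN | hkN
    · have e1 := h1 (k + 1) (by omega)
      have e2 := h2 (k + 1) (by omega)
      push_cast at e1 e2
      have m1 : G t ≤ G (a + (k + 1) * d) := hG (by linarith)
      have m2 : H t ≤ H (a + (k + 1) * d) := hH (by linarith)
      have m3 : G (a + (k + 1) * d + d) ≤ G (t + 2 * d) := hG (by linarith)
      have m4 : H (a + (k + 1) * d + d) ≤ H (t + 2 * d) := hH (by linarith)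
      constructor <;> linarith
    · have hkN' : (N : ℝ) + 1 ≤ k := by exact_mod_cast hkN
      have hmul : (N + 1 : ℝ) * d ≤ k * d := by gcongr
      have e2 := h2 N (by omega)
      have m1 : G (a + N * d + d) ≤ G (t + 2 * d) := hG (by linarith)
      have m2 : H (a + N * d) ≤ H (t + 2 * d) := hH (by linarith)
      constructor
      · linarith [(hH1 t).2]
      · linarith [(hG1 t).2]

theorem quantile_eq_bot {F : ℝ → ℝ} (hF : ∀ t, 0 ≤ F t) {α : ℝ} (hα : α ≤ 0) :
    quantile F α = ⊥ := by
  refine le_bot_iff.1 (EReal.le_of_forall_lt_iff_le.1 fun z _ => ?_)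
  exact sInf_le ⟨z, hα.trans (hF z), rfl⟩

/-- A level strictly above some value of `F` and not above another one has a real quantile. -/
theorem exists_quantile_eq_coe {F : ℝ → ℝ} (hF : Monotone F) {α s₀ s₁ : ℝ} (h0 : F s₀ < α)
    (h1 : α ≤ F s₁) :
    ∃ q : ℝ, quantile F α = q ∧ (∀ s, q < s → α ≤ F s) ∧ ∀ s, s < q → F s < α := by
  have hne : {x | α ≤ F x}.Nonempty := ⟨s₁, h1⟩
  have hbd : BddBelow {x | α ≤ F x} := ⟨s₀, fun x hx => by
    by_contra hlt
    exact absurd (hx.trans (hF (not_le.1 hlt).le)) (not_le.2 h0)⟩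
  have hq1 : ∀ s, sInf {x | α ≤ F x} < s → α ≤ F s := fun s hs => by
    obtain ⟨x, hx, hxs⟩ := exists_lt_of_csInf_lt hne hs
    exact le_trans hx (hF hxs.le)
  refine ⟨sInf {x | α ≤ F x}, ?_, hq1, fun s hs => ?_⟩
  · refine IsGLB.sInf_eq ⟨?_, fun b hb => ?_⟩
    · rintro _ ⟨x, hx, rfl⟩
      exact EReal.coe_le_coe_iff.2 (csInf_le hbd hx)
    · refine EReal.le_of_forall_lt_iff_le.1 fun z hz => ?_
      exact hb ⟨z, hq1 z (EReal.coe_lt_coe_iff.1 hz), rfl⟩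
  · by_contra hle
    exact absurd (csInf_le hbd (not_lt.1 hle)) (not_le.2 hs)

/-- The set of prediction errors covered by the `δ`-distorted interval. -/
def coveredErrors (F : ℝ → ℝ) (α₁ α₂ δ : ℝ) : Set ℝ :=
  {v | quantile F α₁ ≤ ((v + δ : ℝ) : EReal) ∧ ((v - δ : ℝ) : EReal) ≤ quantile F α₂}

theorem measurableSet_coe_add_lt (c : ℝ) (Q : EReal) :
    MeasurableSet {v : ℝ | ((v + c : ℝ) : EReal) < Q} :=
  measurableSet_lt (measurable_coe_real_ereal.comp (measurable_id.add_const c)) measurable_const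

section Coverage

variable {ν : Measure ℝ} [IsProbabilityMeasure ν] {F : ℝ → ℝ}

/-- The two half-line estimates that give coverage: widening the half-line below the `α`-quantile
by `δ` gives mass at least `α - e`, narrowing it by `δ` gives mass at most `α + e`. -/
structure QuantileBounds (ν : Measure ℝ) (F : ℝ → ℝ) (δ e : ℝ) : Prop where
  lower : ∀ α ∈ Set.Icc (0 : ℝ) 1, α - e ≤ ν.real {v | ((v + -δ : ℝ) : EReal) < quantile F α}
  upper : ∀ α ∈ Set.Icc (0 : ℝ) 1, ν.real {v | ((v + δ : ℝ) : EReal) ≤ quantile F α} ≤ α + e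

theorem QuantileBounds.le_coverage {δ e : ℝ} (h : QuantileBounds ν F δ e) {α₁ α₂ : ℝ}
    (hα₁ : α₁ ∈ Set.Icc (0 : ℝ) 1) (hα₂ : α₂ ∈ Set.Icc (0 : ℝ) 1) :
    α₂ - α₁ - 2 * e ≤ ν.real (coveredErrors F α₁ α₂ δ) := by
  have e1 : coveredErrors F α₁ α₂ δ = {v | ((v + -δ : ℝ) : EReal) ≤ quantile F α₂} \
      {v | ((v + δ : ℝ) : EReal) < quantile F α₁} := by
    ext v; simp [coveredErrors, and_comm, sub_eq_add_neg]
  have e2 := le_measureReal_sdiff (μ := ν) (s₂ := {v | ((v + δ : ℝ) : EReal) < quantile F α₁})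
    (s₁ := {v | ((v + -δ : ℝ) : EReal) ≤ quantile F α₂})
  have e3 : ν.real {v | ((v + δ : ℝ) : EReal) < quantile F α₁}
      ≤ ν.real {v | ((v + δ : ℝ) : EReal) ≤ quantile F α₁} :=
    measureReal_mono (Set.ofPred_subset_ofPred.2 fun v hv => le_of_lt hv)
  have e4 : ν.real {v | ((v + -δ : ℝ) : EReal) < quantile F α₂}
      ≤ ν.real {v | ((v + -δ : ℝ) : EReal) ≤ quantile F α₂} :=
    measureReal_mono (Set.ofPred_subset_ofPred.2 fun v hv => le_of_lt hv)
  rw [e1]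
  linarith [h.lower α₂ hα₂, h.upper α₁ hα₁]

theorem QuantileBounds.coverage_le {δ e : ℝ} (h : QuantileBounds ν F δ e) (he : 0 ≤ e) {α₁ α₂ : ℝ}
    (hα₁ : α₁ ∈ Set.Icc (0 : ℝ) 1) (hα₂ : α₂ ∈ Set.Icc (0 : ℝ) 1) (hα : α₁ ≤ α₂) :
    ν.real (coveredErrors F α₁ α₂ (-δ)) ≤ α₂ - α₁ + 2 * e := by
  have e1 : coveredErrors F α₁ α₂ (-δ) = {v | ((v + δ : ℝ) : EReal) ≤ quantile F α₂} \
      {v | ((v + -δ : ℝ) : EReal) < quantile F α₁} := by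
    ext v; simp [coveredErrors, and_comm]
  by_cases hsub : {v : ℝ | ((v + -δ : ℝ) : EReal) < quantile F α₁}
      ⊆ {v | ((v + δ : ℝ) : EReal) ≤ quantile F α₂}
  · rw [e1, measureReal_sdiff hsub (measurableSet_coe_add_lt _ _)]
    linarith [h.lower α₁ hα₁, h.upper α₂ hα₂]
  · -- both sets are lower sets, so the second one contains the first one and nothing is covered
    obtain ⟨w, hw1, hw2⟩ := Set.not_subset.1 hsub
    have e2 : coveredErrors F α₁ α₂ (-δ) = ∅ := by
      rw [e1, Set.sdiff_eq_empty]
      intro v hv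
      have hvw : v ≤ w := by
        by_contra hlt
        refine hw2 (le_trans (EReal.coe_le_coe_iff.2 ?_) hv)
        linarith [not_le.1 hlt]
      exact lt_of_le_of_lt (EReal.coe_le_coe_iff.2 (by linarith)) hw1
    rw [e2, measureReal_empty]
    linarith

/-- `F` behaves like a distribution function that attains the values `0` and `1`. -/
structure IsCdfLike (F : ℝ → ℝ) : Prop where
  mono : Monotone F
  mem : ∀ t, F t ∈ Set.Icc (0 : ℝ) 1
  zero : ∃ s, F s = 0
  one : ∃ s, F s = 1

/-- The distribution function of `ν` and the function `F` are close up to a shift by `d` and an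
error `ε`, as in the definition of the Lévy distance. -/
def ShiftClose (ν : Measure ℝ) (F : ℝ → ℝ) (d ε : ℝ) : Prop :=
  ∀ t, F t ≤ ν.real (Set.Iic (t + d)) + ε ∧ ν.real (Set.Iic t) ≤ F (t + d) + ε

theorem ShiftClose.quantileBounds {d ε δ : ℝ} (h : ShiftClose ν F d ε) (hF : IsCdfLike F)
    (hd : 0 < d) (hε : 0 ≤ ε) (hδ : 3 * d ≤ δ) : QuantileBounds ν F δ ε := by
  obtain ⟨s₀, hs₀⟩ := hF.zero
  obtain ⟨s₁, hs₁⟩ := hF.one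
  constructor
  · rintro α ⟨hα0, hα1⟩
    rcases hα0.eq_or_lt with rfl | hpos
    · linarith [measureReal_nonneg (μ := ν)
        (s := {v : ℝ | ((v + -δ : ℝ) : EReal) < quantile F 0})]
    · obtain ⟨q, hq, hq1, -⟩ := exists_quantile_eq_coe hF.mono (hs₀.trans_lt hpos)
        (hα1.trans_eq hs₁.symm)
      have e1 : ν.real (Set.Iic (q + d + d)) ≤ ν.real {v | ((v + -δ : ℝ) : EReal) < quantile F α} :=
        measureReal_mono fun v hv => by
          have hv' : v ≤ q + d + d := hv
          rw [Set.mem_ofPred_eq, hq, EReal.coe_lt_coe_iff]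
          linarith
      linarith [(h (q + d)).1, hq1 (q + d) (by linarith)]
  · rintro α ⟨hα0, hα1⟩
    rcases hα0.eq_or_lt with rfl | hpos
    · simp [quantile_eq_bot (fun t => (hF.mem t).1) le_rfl, hε]
    · obtain ⟨q, hq, -, hq2⟩ := exists_quantile_eq_coe hF.mono (hs₀.trans_lt hpos)
        (hα1.trans_eq hs₁.symm)
      have e1 : ν.real {v | ((v + δ : ℝ) : EReal) ≤ quantile F α} ≤ ν.real (Set.Iic (q - δ)) :=
        measureReal_mono fun v hv => by
          rw [Set.mem_ofPred_eq, hq, EReal.coe_le_coe_iff] at hv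
          exact Set.mem_Iic.2 (by linarith)
      linarith [(h (q - δ)).2, hq2 (q - δ + d) (by linarith)]

/-- If short intervals have small mass, the distortion of the half-lines can be dropped. -/
theorem QuantileBounds.zero_of_modulus {δ e ω : ℝ} (h : QuantileBounds ν F δ e)
    (hω0 : 0 ≤ ω) (hω : ∀ t, ν.real (Set.Icc t (t + δ)) ≤ ω) : QuantileBounds ν F 0 (e + ω) := by
  have key : ∀ Q : EReal,
      ν.real {v | ((v + -δ : ℝ) : EReal) < Q} ≤ ν.real {v | ((v + -0 : ℝ) : EReal) < Q} + ω ∧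
      ν.real {v | ((v + 0 : ℝ) : EReal) ≤ Q} ≤ ν.real {v | ((v + δ : ℝ) : EReal) ≤ Q} + ω := by
    intro Q
    induction Q with
    | bot => simp [hω0]
    | top =>
      have h1 : ∀ c : ℝ, ν.real {v : ℝ | ((v + c : ℝ) : EReal) < ⊤} = 1 := fun c => by
        rw [Set.eq_univ_of_forall (s := {v : ℝ | ((v + c : ℝ) : EReal) < ⊤})
          fun v => EReal.coe_lt_top _, probReal_univ]
      constructor
      · rw [h1, h1]; linarith
      · simp [hω0]
    | coe q =>
      constructor
      · refine le_trans ?_ (add_le_add_right (hω q) _)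
        refine le_trans (measureReal_mono fun v hv => ?_) (measureReal_union_le _ _)
        simp only [Set.mem_ofPred_eq, EReal.coe_lt_coe_iff, Set.mem_union, Set.mem_Icc] at hv ⊢
        rcases lt_or_ge v q with h1 | h1
        · left; linarith
        · right; constructor <;> linarith
      · refine le_trans ?_ (add_le_add_right (hω (q - δ)) _)
        refine le_trans (measureReal_mono fun v hv => ?_) (measureReal_union_le _ _)
        simp only [Set.mem_ofPred_eq, EReal.coe_le_coe_iff, Set.mem_union, Set.mem_Icc] at hv ⊢
        rcases le_or_gt v (q - δ) with h1 | h1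
        · left; linarith
        · right; constructor <;> linarith
  exact ⟨fun α hα => by linarith [h.lower α hα, (key (quantile F α)).1],
    fun α hα => by linarith [h.upper α hα, (key (quantile F α)).2]⟩

end Coverage

/-! ### Prediction errors and leave-one-out residuals for a fixed law -/

theorem mem_predInterval_iff (A : Algorithm) {p n : ℕ} (T : Fin n → Obs p) (x : Fin p → ℝ)
    (α₁ α₂ δ y : ℝ) :
    y ∈ predInterval A T x α₁ α₂ δ ↔ y - pred A T x ∈ coveredErrors (ecdf A T) α₁ α₂ δ := by
  simp only [predInterval, coveredErrors, Set.mem_Icc, Set.mem_ofPred_eq]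
  refine and_congr ?_ ?_
  · induction quantile (ecdf A T) α₁ with
    | bot => simp [-EReal.coe_add, -EReal.coe_sub]
    | top => simp [-EReal.coe_add, -EReal.coe_sub]
    | coe q =>
      rw [← EReal.coe_sub, ← EReal.coe_add, EReal.coe_le_coe_iff, EReal.coe_le_coe_iff]
      constructor <;> intro h <;> linarith
  · induction quantile (ecdf A T) α₂ with
    | bot => simp [-EReal.coe_add, -EReal.coe_sub]
    | top => simp [-EReal.coe_add, -EReal.coe_sub]
    | coe q =>
      rw [← EReal.coe_add, ← EReal.coe_add, EReal.coe_le_coe_iff, EReal.coe_le_coe_iff]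
      constructor <;> intro h <;> linarith

theorem ecdf_eq_sum_ite (A : Algorithm) {p n : ℕ} (T : Fin n → Obs p) (t : ℝ) :
    ecdf A T t = (1 / (n : ℝ)) * ∑ i : Fin n, if residual A T i ≤ t then (1 : ℝ) else 0 := by
  simp [ecdf, Set.indicator_apply]

theorem isCdfLike_ecdf (A : Algorithm) {p n : ℕ} (hn : 0 < n) (T : Fin n → Obs p) :
    IsCdfLike (ecdf A T) := by
  have hn' : (0 : ℝ) < n := by exact_mod_cast hn
  have : Nonempty (Fin n) := ⟨⟨0, hn⟩⟩
  obtain ⟨i₁, hi₁⟩ := Finite.exists_max (residual A T)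
  obtain ⟨i₀, hi₀⟩ := Finite.exists_min (residual A T)
  have hzero : ecdf A T (residual A T i₀ - 1) = 0 := by
    rw [ecdf_eq_sum_ite, Finset.sum_eq_zero fun i _ => if_neg (by linarith [hi₀ i]), mul_zero]
  have hone : ecdf A T (residual A T i₁) = 1 := by
    rw [ecdf_eq_sum_ite, Finset.sum_congr rfl fun i _ => if_pos (hi₁ i)]
    simp [hn'.ne']
  have hmono : Monotone (ecdf A T) := by
    intro s t hst
    simp only [ecdf_eq_sum_ite]
    refine mul_le_mul_of_nonneg_left (Finset.sum_le_sum fun i _ => ?_) (by positivity)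
    split_ifs <;> linarith
  refine ⟨hmono, fun t => ⟨?_, ?_⟩, ⟨_, hzero⟩, ⟨_, hone⟩⟩
  · rw [ecdf_eq_sum_ite]
    exact mul_nonneg (by positivity) (Finset.sum_nonneg fun i _ => by split_ifs <;> norm_num)
  · calc ecdf A T t ≤ ecdf A T (max t (residual A T i₁)) := hmono (le_max_left _ _)
      _ = 1 := by
        rw [ecdf_eq_sum_ite, Finset.sum_congr rfl fun i _ =>
          if_pos ((hi₁ i).trans (le_max_right t (residual A T i₁)))]
        simp [hn'.ne']

theorem leaveOut_update {E : Type*} {n : ℕ} (T : Fin n → E) (i : Fin n) (w : E) :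
    leaveOut (Function.update T i w) i = leaveOut T i := by
  funext k
  unfold leaveOut
  split_ifs with h
  · rw [Function.update_of_ne]
    exact fun e => by simp [← e] at h
  · rw [Function.update_of_ne]
    exact fun e => by simp [← e] at h

theorem measurable_leaveOut {E : Type*} [MeasurableSpace E] {n : ℕ} (i : Fin n) :
    Measurable fun T : Fin n → E => leaveOut T i := by
  refine measurable_pi_lambda _ fun k => ?_
  unfold leaveOut
  split_ifs <;> exact measurable_pi_apply _

theorem measurable_sub_pred {A : Algorithm}
    (hA : ∀ p n, Measurable (Function.uncurry (A p n))) {p n : ℕ} :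
    Measurable fun q : (Fin n → Obs p) × Obs p => q.2.1 - pred A q.1 q.2.2 := by
  have : Measurable fun q : (Fin n → Obs p) × Obs p => Function.uncurry (A p n) (q.2.2, q.1) :=
    (hA p n).comp (by fun_prop)
  exact (measurable_fst.comp measurable_snd).sub this

theorem measurable_sub_predLoo {A : Algorithm}
    (hA : ∀ p n, Measurable (Function.uncurry (A p n))) {p n : ℕ} (i : Fin n) :
    Measurable fun q : (Fin n → Obs p) × Obs p => q.2.1 - predLoo A q.1 i q.2.2 := by
  have : Measurable fun q : (Fin n → Obs p) × Obs p =>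
      Function.uncurry (A p (n - 1)) (q.2.2, leaveOut q.1 i) :=
    (hA p (n - 1)).comp ((measurable_snd.comp measurable_snd).prodMk
      ((measurable_leaveOut i).comp measurable_fst))
  exact (measurable_fst.comp measurable_snd).sub this

theorem measurable_abs_pred_sub_predLoo {A : Algorithm}
    (hA : ∀ p n, Measurable (Function.uncurry (A p n))) {p n : ℕ} (i : Fin n) :
    Measurable fun q : (Fin n → Obs p) × Obs p => |pred A q.1 q.2.2 - predLoo A q.1 i q.2.2| := by
  have e : (fun q : (Fin n → Obs p) × Obs p => |pred A q.1 q.2.2 - predLoo A q.1 i q.2.2|)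
      = fun q => |(q.2.1 - predLoo A q.1 i q.2.2) - (q.2.1 - pred A q.1 q.2.2)| := by
    funext q; congr 1; ring
  rw [e]
  exact ((measurable_sub_predLoo hA i).sub (measurable_sub_pred hA)).abs

/-- The law of the prediction error of a new observation, given the training data `T`. -/
noncomputable def errorLaw (A : Algorithm) {p n : ℕ} (P : Measure (Obs p)) (T : Fin n → Obs p) :
    Measure ℝ :=
  P.map fun z => z.1 - pred A T z.2

/-- The continuous cutoff that is `1` below `t` and `0` above `t + d`. -/
noncomputable def ramp (t d u : ℝ) : ℝ := max 0 (min 1 ((t + d - u) / d))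

theorem ramp_mem (t d u : ℝ) : ramp t d u ∈ Set.Icc (0 : ℝ) 1 :=
  ⟨le_max_left _ _, max_le zero_le_one (min_le_left _ _)⟩

theorem ramp_eq_one {t d u : ℝ} (hd : 0 < d) (hu : u ≤ t) : ramp t d u = 1 := by
  have : 1 ≤ (t + d - u) / d := by rw [le_div_iff₀ hd]; linarith
  simp [ramp, this]

theorem ramp_eq_zero {t d u : ℝ} (hd : 0 < d) (hu : t + d ≤ u) : ramp t d u = 0 := by
  have : (t + d - u) / d ≤ 0 := div_nonpos_of_nonpos_of_nonneg (by linarith) hd.le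
  exact max_eq_left ((min_le_right _ _).trans this)

theorem measurable_ramp (t d : ℝ) : Measurable (ramp t d) := by unfold ramp; fun_prop

theorem abs_ramp_sub_ramp_le {t d : ℝ} (hd : 0 < d) (u v : ℝ) :
    |ramp t d u - ramp t d v| ≤ |u - v| / d := by
  have h1 : |ramp t d u - ramp t d v|
      ≤ |min 1 ((t + d - u) / d) - min 1 ((t + d - v) / d)| := by
    refine (abs_max_sub_max_le_max _ _ _ _).trans ?_
    simp
  have h2 : |min 1 ((t + d - u) / d) - min 1 ((t + d - v) / d)|
      ≤ |(t + d - u) / d - (t + d - v) / d| := by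
    refine (abs_min_sub_min_le_max _ _ _ _).trans ?_
    simp
  refine h1.trans (h2.trans_eq ?_)
  rw [← sub_div, abs_div, abs_of_pos hd, abs_sub_comm]
  ring_nf

theorem ite_le_ramp {d : ℝ} (hd : 0 < d) (t u : ℝ) :
    (if u ≤ t then (1 : ℝ) else 0) ≤ ramp t d u := by
  split_ifs with h
  · exact (ramp_eq_one hd h).ge
  · exact (ramp_mem t d u).1

theorem ramp_le_ite {d : ℝ} (hd : 0 < d) (t u : ℝ) :
    ramp t d u ≤ if u ≤ t + d then (1 : ℝ) else 0 := by
  split_ifs with h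
  · exact (ramp_mem t d u).2
  · exact (ramp_eq_zero hd (not_le.1 h).le).le

theorem integral_ite_le_eq {ν : Measure ℝ} [IsProbabilityMeasure ν] (t : ℝ) :
    ∫ u, (if u ≤ t then (1 : ℝ) else 0) ∂ν = ν.real (Set.Iic t) := by
  have : (fun u : ℝ => if u ≤ t then (1 : ℝ) else 0) = (Set.Iic t).indicator 1 := by
    funext u; simp [Set.indicator_apply]
  rw [this, integral_indicator_one measurableSet_Iic]

theorem cdf_le_integral_ramp {ν : Measure ℝ} [IsProbabilityMeasure ν] {d : ℝ} (hd : 0 < d) (t : ℝ) :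
    ν.real (Set.Iic t) ≤ ∫ u, ramp t d u ∂ν ∧ ∫ u, ramp t d u ∂ν ≤ ν.real (Set.Iic (t + d)) := by
  have ir : Integrable (ramp t d) ν :=
    integrable_of_measurable_of_abs_le (measurable_ramp t d) (C := 1) fun u => by
      rw [abs_of_nonneg (ramp_mem t d u).1]; exact (ramp_mem t d u).2
  have ii : ∀ t : ℝ, Integrable (fun u : ℝ => if u ≤ t then (1 : ℝ) else 0) ν := fun t =>
    integrable_of_measurable_of_abs_le
      (Measurable.ite measurableSet_Iic measurable_const measurable_const) (C := 1)
      fun u => by split_ifs <;> simp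
  rw [← integral_ite_le_eq, ← integral_ite_le_eq]
  exact ⟨integral_mono (ii t) ir (ite_le_ramp hd t), integral_mono ir (ii _) (ramp_le_ite hd t)⟩

theorem ecdf_le_average_ramp (A : Algorithm) {p n : ℕ} (T : Fin n → Obs p) {d : ℝ} (hd : 0 < d)
    (t : ℝ) :
    ecdf A T t ≤ (1 / (n : ℝ)) * ∑ i, ramp t d (residual A T i) ∧
      (1 / (n : ℝ)) * ∑ i, ramp t d (residual A T i) ≤ ecdf A T (t + d) := by
  simp only [ecdf_eq_sum_ite]
  exact ⟨by gcongr; exact ite_le_ramp hd _ _, by gcongr; exact ramp_le_ite hd _ _⟩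

/-! ### Comparison of the error law with the leave-one-out residuals -/

theorem measurable_sub_pred_right {A : Algorithm}
    (hA : ∀ p n, Measurable (Function.uncurry (A p n))) {p n : ℕ} (T : Fin n → Obs p) :
    Measurable fun z : Obs p => z.1 - pred A T z.2 :=
  (measurable_sub_pred hA).comp (measurable_const.prodMk measurable_id)

theorem isProbabilityMeasure_errorLaw {A : Algorithm}
    (hA : ∀ p n, Measurable (Function.uncurry (A p n))) {p n : ℕ} (P : Measure (Obs p))
    [IsProbabilityMeasure P] (T : Fin n → Obs p) : IsProbabilityMeasure (errorLaw A P T) :=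
  Measure.isProbabilityMeasure_map (measurable_sub_pred_right hA T).aemeasurable

/-- A Lipschitz cutoff changes in mean by at most the Lipschitz part plus the probability of a large
change of the prediction. -/
theorem integral_abs_ramp_sub_ramp_le {A : Algorithm}
    (hA : ∀ p n, Measurable (Function.uncurry (A p n))) {p n : ℕ} (P : Measure (Obs p))
    [IsProbabilityMeasure P] {d e : ℝ} (hd : 0 < d) (he : 0 ≤ e) (t : ℝ) (i : Fin n) :
    ∫ q : (Fin n → Obs p) × Obs p, |ramp t d (q.2.1 - pred A q.1 q.2.2)
        - ramp t d (q.2.1 - predLoo A q.1 i q.2.2)| ∂((Measure.pi fun _ => P).prod P)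
      ≤ e / d + ((Measure.pi fun _ => P).prod P).real
          {q : (Fin n → Obs p) × Obs p | e ≤ |pred A q.1 q.2.2 - predLoo A q.1 i q.2.2|} := by
  have m1 := measurable_sub_pred hA (p := p) (n := n)
  have m2 := measurable_sub_predLoo hA (p := p) i
  have mS : MeasurableSet
      {q : (Fin n → Obs p) × Obs p | e ≤ |pred A q.1 q.2.2 - predLoo A q.1 i q.2.2|} :=
    measurableSet_le measurable_const (measurable_abs_pred_sub_predLoo hA i)
  set S := {q : (Fin n → Obs p) × Obs p | e ≤ |pred A q.1 q.2.2 - predLoo A q.1 i q.2.2|}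
  have iS : Integrable (S.indicator (1 : (Fin n → Obs p) × Obs p → ℝ))
      ((Measure.pi fun _ => P).prod P) := (integrable_const 1).indicator mS
  have iL := (integrable_of_measurable_of_abs_le (m := (Measure.pi fun _ => P).prod P)
    (((measurable_ramp t d).comp m1).sub ((measurable_ramp t d).comp m2))
    fun q => abs_sub_le_one (ramp_mem t d _) (ramp_mem t d _)).abs
  refine (integral_mono iL ((integrable_const (e / d)).add iS) fun q => ?_).trans_eq ?_
  · simp only [Pi.sub_apply, Function.comp_apply, Pi.add_apply]
    by_cases hq : q ∈ S
    · rw [Set.indicator_of_mem hq]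
      have := abs_sub_le_one (ramp_mem t d (q.2.1 - pred A q.1 q.2.2))
        (ramp_mem t d (q.2.1 - predLoo A q.1 i q.2.2))
      have h0 : 0 ≤ e / d := div_nonneg he hd.le
      simp only [Pi.one_apply]
      linarith
    · rw [Set.indicator_of_notMem hq, add_zero]
      have hq' : |pred A q.1 q.2.2 - predLoo A q.1 i q.2.2| < e := not_le.1 hq
      refine (abs_ramp_sub_ramp_le hd _ _).trans ?_
      have : |q.2.1 - pred A q.1 q.2.2 - (q.2.1 - predLoo A q.1 i q.2.2)|
          = |pred A q.1 q.2.2 - predLoo A q.1 i q.2.2| := by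
        rw [← abs_neg]; congr 1; ring
      rw [this]
      gcongr
  · simp only [Pi.add_apply]
    rw [integral_add (integrable_const _) iS, integral_indicator_one mS]
    simp

/-- The average over `i` of the probabilities that leaving out the `i`-th observation changes the
prediction at a new observation by at least `e`. -/
noncomputable def instability (A : Algorithm) {p : ℕ} (n : ℕ) (P : Measure (Obs p)) (e : ℝ) : ℝ :=
  (1 / (n : ℝ)) * ∑ i : Fin n, ((Measure.pi fun _ => P).prod P).real
    {q : (Fin n → Obs p) × Obs p | e ≤ |pred A q.1 q.2.2 - predLoo A q.1 i q.2.2|}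

theorem integral_sq_average_ramp_sub_le {A : Algorithm}
    (hA : ∀ p n, Measurable (Function.uncurry (A p n))) {p n : ℕ} (hn : 0 < n) (P : Measure (Obs p))
    [IsProbabilityMeasure P] {d e : ℝ} (hd : 0 < d) (he : 0 ≤ e) (t : ℝ) :
    ∫ T : Fin n → Obs p, ((1 / (n : ℝ)) * ∑ i, ramp t d (residual A T i)
        - ∫ z, ramp t d (z.1 - pred A T z.2) ∂P) ^ 2 ∂(Measure.pi fun _ => P)
      ≤ 1 / (n : ℝ) + 12 * (e / d + instability A n P e) := by
  have hn' : (0 : ℝ) < n := by exact_mod_cast hn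
  refine (integral_sq_average_loo_sub_mean_le hn (P := P)
    (h := fun q => ramp t d (q.2.1 - pred A q.1 q.2.2))
    (g := fun i q => ramp t d (q.2.1 - predLoo A q.1 i q.2.2))
    ((measurable_ramp t d).comp (measurable_sub_pred hA))
    (fun i => (measurable_ramp t d).comp (measurable_sub_predLoo hA i))
    (fun q => ramp_mem t d _) (fun i q => ramp_mem t d _)
    (fun i T w z => by simp only [predLoo, leaveOut_update])).trans ?_
  gcongr
  refine (mul_le_mul_of_nonneg_left (Finset.sum_le_sum fun i _ =>
    integral_abs_ramp_sub_ramp_le hA P hd he t i) (by positivity)).trans_eq ?_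
  rw [Finset.sum_add_distrib, mul_add, instability]
  congr 1
  simp only [Finset.sum_const, Finset.card_univ, Fintype.card_fin, nsmul_eq_mul]
  field_simp

/-- Outside an event of small probability, the error distribution and the empirical distribution of
the leave-one-out residuals are close up to a shift. -/
theorem exists_bad_set_shiftClose {A : Algorithm}
    (hA : ∀ p n, Measurable (Function.uncurry (A p n))) {p n : ℕ} (hn : 0 < n) (P : Measure (Obs p))
    [IsProbabilityMeasure P] {d e ε K : ℝ} (hd : 0 < d) (he : 0 ≤ e) (hε : 0 < ε) (N : ℕ)
    (hN : 2 * K + 2 * d ≤ N * d) :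
    ∃ B : Set (Fin n → Obs p),
      (Measure.pi fun _ => P).real B
        ≤ (N + 2) * ((1 / (n : ℝ) + 12 * (e / d + instability A n P e)) / ε ^ 2)
          + ((Measure.pi fun _ => P).prod P).real
            {q : (Fin n → Obs p) × Obs p | K < |q.2.1 - pred A q.1 q.2.2|} / ε ∧
      ∀ T ∉ B, ShiftClose (errorLaw A P T) (ecdf A T) (2 * d) (2 * ε) := by
  have m1 := measurable_sub_pred hA (p := p) (n := n)
  have m1' := measurable_sub_pred_right hA (p := p) (n := n)
  set V := 1 / (n : ℝ) + 12 * (e / d + instability A n P e)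
  -- the grid starts so low that even its second point lies below `-K`
  let a : ℝ := -K - 2 * d
  let t : ℕ → ℝ := fun k => a + k * d
  let Δ : ℕ → (Fin n → Obs p) → ℝ := fun k T =>
    (1 / (n : ℝ)) * ∑ i, ramp (t k) d (residual A T i) - ∫ z, ramp (t k) d (z.1 - pred A T z.2) ∂P
  let W : Set ((Fin n → Obs p) × Obs p) := {q | K < |q.2.1 - pred A q.1 q.2.2|}
  have mW : MeasurableSet W := measurableSet_lt measurable_const m1.abs
  let w : (Fin n → Obs p) → ℝ := fun T => ∫ z, W.indicator 1 (T, z) ∂P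
  have iW : Integrable (W.indicator (1 : (Fin n → Obs p) × Obs p → ℝ))
      ((Measure.pi fun _ => P).prod P) := (integrable_const 1).indicator mW
  have hW01 : ∀ q, W.indicator (1 : (Fin n → Obs p) × Obs p → ℝ) q ∈ Set.Icc (0 : ℝ) 1 :=
    fun q => by by_cases hq : q ∈ W <;> simp [hq]
  have hmean : ∀ k, Measurable fun T : Fin n → Obs p =>
      ∫ z, ramp (t k) d (z.1 - pred A T z.2) ∂P := fun k =>
    (((measurable_ramp (t k) d).comp m1).stronglyMeasurable.integral_prod_right'
      (ν := P)).measurable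
  have mres : ∀ i : Fin n, Measurable fun T : Fin n → Obs p => residual A T i := fun i =>
    (measurable_sub_predLoo hA i).comp (measurable_id.prodMk (measurable_pi_apply i))
  have hΔm : ∀ k, Measurable (Δ k) := fun k =>
    ((Finset.measurable_sum _ fun i _ =>
      (measurable_ramp (t k) d).comp (mres i)).const_mul _).sub (hmean k)
  have iramp : ∀ k T, ∫ z, ramp (t k) d (z.1 - pred A T z.2) ∂P
      = ∫ u, ramp (t k) d u ∂(errorLaw A P T) := fun k T => by
    rw [errorLaw, integral_map (m1' T).aemeasurable (measurable_ramp _ _).aestronglyMeasurable]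
  have hΔ1 : ∀ k T, |Δ k T| ≤ 1 := by
    intro k T
    have := isProbabilityMeasure_errorLaw hA P T
    have h1 := ecdf_le_average_ramp A T hd (t k)
    have h2 := cdf_le_integral_ramp (ν := errorLaw A P T) hd (t k)
    have hF := (isCdfLike_ecdf A hn T).mem
    rw [← iramp] at h2
    exact abs_sub_le_one ⟨(hF _).1.trans h1.1, h1.2.trans (hF _).2⟩
      ⟨measureReal_nonneg.trans h2.1, h2.2.trans measureReal_le_one⟩
  have iΔ : ∀ k, Integrable (fun T => Δ k T ^ 2) (Measure.pi fun _ => P) := fun k =>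
    integrable_of_measurable_of_abs_le ((hΔm k).pow_const 2) (C := 1) fun T => by
      rw [abs_pow]; exact pow_le_one₀ (abs_nonneg _) (hΔ1 k T)
  let Bk : ℕ → Set (Fin n → Obs p) := fun k => {T | ε ^ 2 ≤ Δ k T ^ 2}
  let Bw : Set (Fin n → Obs p) := {T | ε ≤ w T}
  have hBk : ∀ k, (Measure.pi fun _ => P).real (Bk k) ≤ V / ε ^ 2 := fun k => by
    rw [le_div_iff₀ (by positivity), mul_comm]
    exact (mul_meas_ge_le_integral_of_nonneg (ae_of_all _ fun T => sq_nonneg _) (iΔ k) _).trans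
      (integral_sq_average_ramp_sub_le hA hn P hd he (t k))
  have hBw : (Measure.pi fun _ => P).real Bw ≤ ((Measure.pi fun _ => P).prod P).real W / ε := by
    rw [le_div_iff₀ hε, mul_comm, ← integral_indicator_one mW, integral_prod _ iW]
    exact mul_meas_ge_le_integral_of_nonneg
      (ae_of_all _ fun T => integral_nonneg fun z => (hW01 _).1) iW.integral_prod_left _
  refine ⟨(⋃ k ∈ Finset.range (N + 2), Bk k) ∪ Bw, ?_, fun T hT => ?_⟩
  · refine (measureReal_union_le _ _).trans (add_le_add ?_ hBw)
    refine (measureReal_biUnion_finset_le _ _).trans ?_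
    refine (Finset.sum_le_sum fun k _ => hBk k).trans_eq ?_
    simp
  · have hprob := isProbabilityMeasure_errorLaw hA P T
    have hF := isCdfLike_ecdf A hn T
    simp only [Set.mem_union, Set.mem_iUnion, Finset.mem_range, not_or, not_exists] at hT
    have hk : ∀ k : ℕ, k ≤ N + 1 → |Δ k T| < ε := fun k hk => by
      have := hT.1 k (by omega)
      exact abs_lt_of_sq_lt_sq (not_le.1 this) hε.le
    have hw : (errorLaw A P T).real {v | K < |v|} < ε := by
      have h1 : w T = (errorLaw A P T).real {v | K < |v|} := by
        have h2 : ∀ z : Obs p, W.indicator (1 : (Fin n → Obs p) × Obs p → ℝ) (T, z)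
            = ({z : Obs p | K < |z.1 - pred A T z.2|}).indicator 1 z := fun z => rfl
        simp only [w, h2]
        rw [integral_indicator_one (measurableSet_lt measurable_const (m1' T).abs), errorLaw,
          map_measureReal_apply (m1' T) (measurableSet_lt measurable_const
            continuous_abs.measurable)]
        rfl
      rw [← h1]
      exact not_le.1 hT.2
    have hmono : Monotone fun t => (errorLaw A P T).real (Set.Iic t) := fun s t hst =>
      measureReal_mono (Set.Iic_subset_Iic.2 hst)
    intro s
    have hgrid := shift_close_of_grid (G := ecdf A T)
      (H := fun t => (errorLaw A P T).real (Set.Iic t)) hF.mono hmono hF.mem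
      (fun t => ⟨measureReal_nonneg, measureReal_le_one⟩) hd hε.le (a := a) N
      (fun k hkN => ?_) (fun k hkN => ?_) ?_ ?_ s
    · exact ⟨hgrid.2, hgrid.1⟩
    · have h1 := ecdf_le_average_ramp A T hd (t k)
      have h2 := cdf_le_integral_ramp (ν := errorLaw A P T) hd (t k)
      have h3 := (abs_lt.1 (hk k hkN)).2
      simp only [Δ, iramp] at h3
      linarith
    · have h1 := ecdf_le_average_ramp A T hd (t k)
      have h2 := cdf_le_integral_ramp (ν := errorLaw A P T) hd (t k)
      have h3 := (abs_lt.1 (hk k hkN)).1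
      simp only [Δ, iramp] at h3
      linarith
    · refine le_trans (measureReal_mono fun v hv => ?_) hw.le
      have hv' : v ≤ a + d := hv
      simp only [a] at hv'
      exact lt_of_lt_of_le (by linarith) (neg_le_abs v)
    · have h1 : (errorLaw A P T).real (Set.Iic (a + N * d))ᶜ ≤ ε := by
        refine le_trans (measureReal_mono fun v hv => ?_) hw.le
        have hv' : a + N * d < v := not_le.1 hv
        simp only [a] at hv'
        exact lt_of_lt_of_le (by linarith) (le_abs_self v)
      rw [probReal_compl_eq_one_sub measurableSet_Iic] at h1
      linarith

/-! ### Bounded conditional densities -/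

theorem measure_Icc_le_densitySup_mul {ν : Measure ℝ} [IsProbabilityMeasure ν]
    (hν : ν ≪ volume) (a b : ℝ) : ν (Set.Icc a b) ≤ densitySup ν * ENNReal.ofReal (b - a) := by
  conv_lhs => rw [← Measure.withDensity_rnDeriv_eq ν volume hν]
  rw [withDensity_apply _ measurableSet_Icc]
  refine (lintegral_mono_ae (ae_restrict_of_ae ae_le_essSup)).trans_eq ?_
  rw [setLIntegral_const, Real.volume_Icc]
  rfl

/-- Up to the probability that the conditional density is not bounded by `K`, the prediction error
falls into an interval of length `d` with probability at most `K d`, whatever the training data. -/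
theorem errorLaw_Icc_le {A : Algorithm}
    (hA : ∀ p n, Measurable (Function.uncurry (A p n))) {p n : ℕ} (P : Measure (Obs p))
    [IsProbabilityMeasure P] (hac : ∀ᵐ x ∂(P.map Prod.snd), condLaw P x ≪ volume)
    {K : ℝ≥0} {η : ℝ} (hη : 0 ≤ η)
    (hK : (P.map Prod.snd) {x | (K : ℝ≥0∞) < densitySup (condLaw P x)} ≤ ENNReal.ofReal η)
    (T : Fin n → Obs p) {d : ℝ} (hd : 0 ≤ d) (t : ℝ) :
    (errorLaw A P T).real (Set.Icc t (t + d)) ≤ K * d + η := by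
  have m1 := measurable_sub_pred_right hA T
  have m2 : Measurable fun q : (Fin p → ℝ) × ℝ => q.2 - pred A T q.1 :=
    m1.comp measurable_swap
  have hp : IsProbabilityMeasure (P.map Prod.snd) :=
    Measure.isProbabilityMeasure_map measurable_snd.aemeasurable
  have mS : MeasurableSet {q : (Fin p → ℝ) × ℝ | q.2 - pred A T q.1 ∈ Set.Icc t (t + d)} :=
    m2 measurableSet_Icc
  have e1 : errorLaw A P T (Set.Icc t (t + d))
      = ∫⁻ x, condLaw P x (Set.Icc (t + pred A T x) (t + pred A T x + d)) ∂(P.map Prod.snd) := by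
    have h1 : errorLaw A P T (Set.Icc t (t + d))
        = (P.map fun z => (z.2, z.1)) {q | q.2 - pred A T q.1 ∈ Set.Icc t (t + d)} := by
      rw [errorLaw, Measure.map_apply m1 measurableSet_Icc, Measure.map_apply (by fun_prop) mS]
      rfl
    rw [h1, ← compProd_map_condDistrib measurable_fst.aemeasurable, Measure.compProd_apply mS]
    refine lintegral_congr fun x => ?_
    congr 1
    ext y
    simp only [Set.mem_preimage, Set.mem_ofPred_eq, Set.mem_Icc]
    constructor <;> rintro ⟨h1, h2⟩ <;> constructor <;> linarith
  let B := toMeasurable (P.map Prod.snd) {x | (K : ℝ≥0∞) < densitySup (condLaw P x)}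
  have hpt : ∀ᵐ x ∂(P.map Prod.snd),
      condLaw P x (Set.Icc (t + pred A T x) (t + pred A T x + d))
        ≤ K * ENNReal.ofReal d + B.indicator 1 x := by
    filter_upwards [hac] with x hx
    have hpx : IsProbabilityMeasure (condLaw P x) := by unfold condLaw; infer_instance
    by_cases hxB : x ∈ B
    · rw [Set.indicator_of_mem hxB]
      exact prob_le_one.trans le_add_self
    · refine le_trans ?_ le_self_add
      refine (measure_Icc_le_densitySup_mul hx _ _).trans ?_
      rw [add_sub_cancel_left]
      gcongr
      by_contra hlt
      exact hxB (subset_toMeasurable _ _ (not_le.1 hlt))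
  have e2 : errorLaw A P T (Set.Icc t (t + d)) ≤ ENNReal.ofReal (K * d + η) := by
    rw [e1]
    refine (lintegral_mono_ae hpt).trans ?_
    rw [lintegral_add_left measurable_const,
      lintegral_indicator_one (measurableSet_toMeasurable _ _),
      measure_toMeasurable, lintegral_const, measure_univ, mul_one,
      ENNReal.ofReal_add (by positivity) hη, ENNReal.ofReal_mul K.coe_nonneg,
      ENNReal.ofReal_coe_nnreal]
    gcongr
  exact ENNReal.toReal_le_of_le_ofReal (by positivity) e2

/-! ### Measurability of the supremum over all levels -/

/-- The conditional coverage given the training data `T`. -/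
noncomputable def coverage (A : Algorithm) {p n : ℕ} (P : Measure (Obs p)) (T : Fin n → Obs p)
    (α₁ α₂ δ : ℝ) : ℝ :=
  P.real {z : Obs p | z.1 ∈ predInterval A T z.2 α₁ α₂ δ}

theorem measurableSet_coveredErrors (F : ℝ → ℝ) (α₁ α₂ δ : ℝ) :
    MeasurableSet (coveredErrors F α₁ α₂ δ) := by
  have h1 : MeasurableSet {v : ℝ | quantile F α₁ ≤ ((v + δ : ℝ) : EReal)} :=
    measurableSet_le measurable_const (measurable_coe_real_ereal.comp (measurable_id.add_const δ))
  have h2 : MeasurableSet {v : ℝ | ((v - δ : ℝ) : EReal) ≤ quantile F α₂} :=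
    measurableSet_le (measurable_coe_real_ereal.comp (measurable_id.sub_const δ)) measurable_const
  exact h1.inter h2

theorem coverage_eq_errorLaw {A : Algorithm}
    (hA : ∀ p n, Measurable (Function.uncurry (A p n))) {p n : ℕ} (P : Measure (Obs p))
    (T : Fin n → Obs p) (α₁ α₂ δ : ℝ) :
    coverage A P T α₁ α₂ δ = (errorLaw A P T).real (coveredErrors (ecdf A T) α₁ α₂ δ) := by
  rw [errorLaw, map_measureReal_apply (measurable_sub_pred_right hA T)
    (measurableSet_coveredErrors _ _ _ _), coverage]
  congr 1
  ext z
  exact mem_predInterval_iff A T z.2 α₁ α₂ δ z.1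

theorem coverage_mem (A : Algorithm) {p n : ℕ} (P : Measure (Obs p)) [IsProbabilityMeasure P]
    (T : Fin n → Obs p) (α₁ α₂ δ : ℝ) : coverage A P T α₁ α₂ δ ∈ Set.Icc (0 : ℝ) 1 :=
  ⟨measureReal_nonneg, measureReal_le_one⟩

/-- By monotonicity, rational points suffice in the definition of the quantile. -/
theorem quantile_eq_iInf_rat {F : ℝ → ℝ} (hF : Monotone F) (α : ℝ) :
    quantile F α = ⨅ r : ℚ, if α ≤ F r then (((r : ℝ) : EReal)) else ⊤ := by
  refine le_antisymm (le_iInf fun r => ?_) (le_sInf ?_)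
  · split_ifs with h
    · exact sInf_le ⟨r, h, rfl⟩
    · exact le_top
  · rintro _ ⟨x, hx, rfl⟩
    refine EReal.le_of_forall_lt_iff_le.1 fun z hz => ?_
    obtain ⟨r, hr1, hr2⟩ := exists_rat_btwn (EReal.coe_lt_coe_iff.1 hz)
    refine (iInf_le _ r).trans ?_
    rw [if_pos (le_trans hx (hF hr1.le))]
    exact EReal.coe_le_coe_iff.2 hr2.le

theorem measurable_quantile_ecdf {A : Algorithm}
    (hA : ∀ p n, Measurable (Function.uncurry (A p n))) {p n : ℕ} (hn : 0 < n) (α : ℝ) :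
    Measurable fun T : Fin n → Obs p => quantile (ecdf A T) α := by
  have e : (fun T : Fin n → Obs p => quantile (ecdf A T) α)
      = fun T => ⨅ r : ℚ, if α ≤ ecdf A T r then (((r : ℝ) : EReal)) else ⊤ :=
    funext fun T => quantile_eq_iInf_rat (isCdfLike_ecdf A hn T).mono α
  rw [e]
  refine Measurable.iInf fun r => Measurable.ite ?_ measurable_const measurable_const
  refine measurableSet_le measurable_const ?_
  simp only [ecdf_eq_sum_ite]
  refine (Finset.measurable_sum _ fun i _ => Measurable.ite ?_ measurable_const
    measurable_const).const_mul _
  exact measurableSet_le ((measurable_sub_predLoo hA i).comp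
    (measurable_id.prodMk (measurable_pi_apply i))) measurable_const

theorem measurable_coverage {A : Algorithm}
    (hA : ∀ p n, Measurable (Function.uncurry (A p n))) {p n : ℕ} (hn : 0 < n) (P : Measure (Obs p))
    [IsProbabilityMeasure P] (α₁ α₂ δ : ℝ) :
    Measurable fun T : Fin n → Obs p => coverage A P T α₁ α₂ δ := by
  have mq (α : ℝ) : Measurable fun q : (Fin n → Obs p) × Obs p => quantile (ecdf A q.1) α :=
    (measurable_quantile_ecdf hA hn α).comp measurable_fst
  have m1 := measurable_sub_pred hA (p := p) (n := n)
  have h1 : MeasurableSet {q : (Fin n → Obs p) × Obs p |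
      quantile (ecdf A q.1) α₁ ≤ ((q.2.1 - pred A q.1 q.2.2 + δ : ℝ) : EReal)} :=
    measurableSet_le (mq α₁) (measurable_coe_real_ereal.comp (m1.add_const δ))
  have h2 : MeasurableSet {q : (Fin n → Obs p) × Obs p |
      ((q.2.1 - pred A q.1 q.2.2 - δ : ℝ) : EReal) ≤ quantile (ecdf A q.1) α₂} :=
    measurableSet_le (measurable_coe_real_ereal.comp (m1.sub_const δ)) (mq α₂)
  have hS : MeasurableSet {q : (Fin n → Obs p) × Obs p |
      q.2.1 ∈ predInterval A q.1 q.2.2 α₁ α₂ δ} := by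
    simp only [mem_predInterval_iff]
    exact h1.inter h2
  exact (measurable_measure_prodMk_left (ν := P) hS).ennreal_toReal

/-- The empirical distribution function takes finitely many values, so its quantiles are constant
on small left neighbourhoods of a level. -/
theorem exists_lt_quantile_ecdf_eq (A : Algorithm) {p n : ℕ} (T : Fin n → Obs p) (α : ℝ) :
    ∃ β < α, ∀ r ∈ Set.Ioc β α, quantile (ecdf A T) r = quantile (ecdf A T) α := by
  have hfin : (Set.range (ecdf A T)).Finite := by
    refine (Set.finite_range fun s : Set (Fin n) =>
      (1 / (n : ℝ)) * ∑ i : Fin n, s.indicator (fun _ => (1 : ℝ)) i).subset ?_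
    rintro _ ⟨t, rfl⟩
    refine ⟨{i | residual A T i ≤ t}, ?_⟩
    rw [ecdf_eq_sum_ite]
    simp [Set.indicator_apply]
  have hev : ∀ᶠ β in 𝓝[<] α, ∀ v ∈ Set.range (ecdf A T), v < α → v < β := by
    rw [eventually_all_finite hfin]
    intro v _
    by_cases hv : v < α
    · filter_upwards [nhdsWithin_le_nhds (lt_mem_nhds hv)] with β hβ _ using hβ
    · exact Eventually.of_forall fun β h => absurd h hv
  obtain ⟨β, hβ, hβα⟩ := (hev.and self_mem_nhdsWithin).exists
  refine ⟨β, hβα, fun r hr => ?_⟩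
  have : {x | r ≤ ecdf A T x} = {x | α ≤ ecdf A T x} := by
    ext x
    refine ⟨fun hx => ?_, fun hx => hr.2.trans hx⟩
    by_contra hlt
    exact absurd (hβ _ ⟨x, rfl⟩ (not_le.1 hlt)) (not_lt.2 (hr.1.le.trans hx))
  rw [quantile, quantile, this]

/-- The rational pairs of levels. -/
abbrev RatLevels : Type := {a : ℚ × ℚ // ((a.1 : ℝ), (a.2 : ℝ)) ∈ levels}

/-- Every pair of levels can be replaced, up to an arbitrarily small change, by a rational one with
the same quantiles. -/
theorem exists_ratLevels (A : Algorithm) {p n : ℕ} (T : Fin n → Obs p) {α₁ α₂ : ℝ}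
    (hα : (α₁, α₂) ∈ levels) {η : ℝ} (hη : 0 < η) :
    ∃ a : RatLevels, |(a.1.1 : ℝ) - α₁| ≤ η ∧ |(a.1.2 : ℝ) - α₂| ≤ η ∧
      quantile (ecdf A T) a.1.1 = quantile (ecdf A T) α₁ ∧
      quantile (ecdf A T) a.1.2 = quantile (ecdf A T) α₂ := by
  obtain ⟨h0, h12, h1⟩ := hα
  simp only at h0 h12 h1
  -- a rational level in `[0, α]` with the same quantile, above any given number `c < α`
  have step : ∀ α : ℝ, 0 ≤ α → ∀ c < α, ∃ r : ℚ, 0 ≤ (r : ℝ) ∧ (r : ℝ) ≤ α ∧ α - η ≤ r ∧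
      (α ≠ 0 → c < r) ∧ quantile (ecdf A T) r = quantile (ecdf A T) α := by
    intro α hα c hc
    rcases hα.eq_or_lt with rfl | hpos
    · exact ⟨0, by simp [hη.le]⟩
    · obtain ⟨β, hβ, hq⟩ := exists_lt_quantile_ecdf_eq A T α
      obtain ⟨r, hr1, hr2⟩ := exists_rat_btwn
        (max_lt (max_lt hβ hc) (max_lt hpos (sub_lt_self α hη)))
      simp only [max_lt_iff] at hr1
      exact ⟨r, hr1.2.1.le, hr2.le, hr1.2.2.le, fun _ => hr1.1.2, hq r ⟨hr1.1.1, hr2.le⟩⟩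
  rcases h12.eq_or_lt with rfl | hlt
  · obtain ⟨r, hr0, hr1, hr2, -, hq⟩ := step α₁ h0 (α₁ - 1) (by linarith)
    exact ⟨⟨(r, r), hr0, le_rfl, hr1.trans h1⟩, by rw [abs_le]; constructor <;> linarith,
      by rw [abs_le]; constructor <;> linarith, hq, hq⟩
  · obtain ⟨r, hr0, hr1, hr2, -, hq⟩ := step α₁ h0 (α₁ - 1) (by linarith)
    obtain ⟨s, hs0, hs1, hs2, hs3, hqs⟩ := step α₂ (h0.trans h12) α₁ hlt
    have := hs3 (h0.trans_lt hlt).ne'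
    exact ⟨⟨(r, s), hr0, hr1.trans this.le, hs1.trans h1⟩,
      by rw [abs_le]; constructor <;> linarith, by rw [abs_le]; constructor <;> linarith, hq, hqs⟩

/-- The largest deviation of the conditional coverage of the undistorted interval from its nominal
value. -/
noncomputable def supDeviation (A : Algorithm) {p n : ℕ} (P : Measure (Obs p))
    (T : Fin n → Obs p) : ℝ :=
  ⨆ a : levels, |coverage A P T a.1.1 a.1.2 0 - (a.1.2 - a.1.1)|

theorem abs_coverage_sub_le_one (A : Algorithm) {p n : ℕ} (P : Measure (Obs p))
    [IsProbabilityMeasure P] (T : Fin n → Obs p) {a : ℝ × ℝ} (ha : a ∈ levels) (δ : ℝ) :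
    |coverage A P T a.1 a.2 δ - (a.2 - a.1)| ≤ 1 :=
  abs_sub_le_one (coverage_mem A P T _ _ δ) ⟨by linarith [ha.2.1], by linarith [ha.1, ha.2.2]⟩

instance nonempty_levels : Nonempty levels := ⟨⟨(0, 0), le_rfl, le_rfl, zero_le_one⟩⟩

theorem supDeviation_mem (A : Algorithm) {p n : ℕ} (P : Measure (Obs p))
    [IsProbabilityMeasure P] (T : Fin n → Obs p) : supDeviation A P T ∈ Set.Icc (0 : ℝ) 1 :=
  ⟨Real.iSup_nonneg fun _ => abs_nonneg _,
    ciSup_le fun a => abs_coverage_sub_le_one A P T a.2 0⟩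

theorem measurable_supDeviation {A : Algorithm}
    (hA : ∀ p n, Measurable (Function.uncurry (A p n))) {p n : ℕ} (hn : 0 < n) (P : Measure (Obs p))
    [IsProbabilityMeasure P] :
    Measurable fun T : Fin n → Obs p => supDeviation A P T := by
  have hne : Nonempty RatLevels := ⟨⟨(0, 0), by simp [levels]⟩⟩
  have e : ∀ T : Fin n → Obs p, supDeviation A P T
      = ⨆ a : RatLevels, |coverage A P T a.1.1 a.1.2 0 - (a.1.2 - a.1.1)| := by
    intro T
    have hb1 : BddAbove (Set.range fun a : levels =>
        |coverage A P T a.1.1 a.1.2 0 - (a.1.2 - a.1.1)|) :=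
      ⟨1, by rintro _ ⟨a, rfl⟩; exact abs_coverage_sub_le_one A P T a.2 0⟩
    have hb2 : BddAbove (Set.range fun a : RatLevels =>
        |coverage A P T a.1.1 a.1.2 0 - (a.1.2 - a.1.1)|) :=
      ⟨1, by rintro _ ⟨a, rfl⟩; exact abs_coverage_sub_le_one A P T a.2 0⟩
    refine le_antisymm (ciSup_le fun a => ?_) (ciSup_le fun a => ?_)
    · refine le_of_forall_pos_le_add fun η hη => ?_
      obtain ⟨b, hb1', hb2', hq1, hq2⟩ := exists_ratLevels A T a.2 (half_pos hη)
      have hc : coverage A P T b.1.1 b.1.2 0 = coverage A P T a.1.1 a.1.2 0 := by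
        simp only [coverage_eq_errorLaw hA, coveredErrors, hq1, hq2]
      have hle := le_ciSup hb2 b
      simp only [hc] at hle
      refine le_trans ?_ (add_le_add_left hle η)
      have htri := abs_sub_le (coverage A P T a.1.1 a.1.2 0 - (a.1.2 - a.1.1))
        (coverage A P T a.1.1 a.1.2 0 - (b.1.2 - b.1.1)) 0
      simp only [sub_zero] at htri
      have hd : |(coverage A P T a.1.1 a.1.2 0 - (a.1.2 - a.1.1))
          - (coverage A P T a.1.1 a.1.2 0 - (b.1.2 - b.1.1))| ≤ η := by
        rw [abs_le] at hb1' hb2' ⊢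
        constructor <;> linarith [hb1'.1, hb1'.2, hb2'.1, hb2'.2]
      linarith
    · exact le_ciSup hb1 ⟨((a.1.1 : ℝ), (a.1.2 : ℝ)), a.2⟩
  rw [funext e]
  exact Measurable.iSup fun a => ((measurable_coverage hA hn P _ _ 0).sub_const _).abs

/-! ### The i.i.d. sample -/

section Sample

variable {Ω : Type*} [MeasurableSpace Ω] {μ : Measure Ω} [IsProbabilityMeasure μ] {p n : ℕ}
  {P : Measure (Obs p)} [IsProbabilityMeasure P] {Z : Fin (n + 1) → Ω → Obs p}

/-- The training data and the new observation have the product law. -/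
theorem measurePreserving_train_newObs (hZ : ∀ i, Measurable (Z i)) (hlaw : ∀ i, μ.map (Z i) = P)
    (hindep : iIndepFun Z μ) :
    MeasurePreserving (fun ω => (train Z ω, newObs Z ω)) μ ((Measure.pi fun _ => P).prod P) := by
  have h1 : MeasurePreserving (fun ω i => Z i ω) μ (Measure.pi fun _ => P) := by
    refine ⟨measurable_pi_lambda _ hZ, ?_⟩
    rw [(iIndepFun_iff_map_fun_eq_pi_map fun i => (hZ i).aemeasurable).1 hindep]
    simp only [hlaw]
  have h2 := (measurePreserving_piFinSuccAbove (fun _ : Fin (n + 1) => P) (Fin.last n)).comp h1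
  have h3 := (Measure.measurePreserving_swap (μ := P) (ν := Measure.pi fun _ : Fin n => P)).comp h2
  convert h3 using 1
  funext ω
  refine Prod.ext (funext fun i => ?_) rfl
  change Z i.castSucc ω = Z ((Fin.last n).succAbove i) ω
  rw [Fin.succAbove_last]

theorem measurePreserving_train (hZ : ∀ i, Measurable (Z i)) (hlaw : ∀ i, μ.map (Z i) = P)
    (hindep : iIndepFun Z μ) : MeasurePreserving (train Z) μ (Measure.pi fun _ => P) :=
  measurePreserving_fst.comp (measurePreserving_train_newObs hZ hlaw hindep)

/-- By independence, conditioning on the training data leaves the law of the new observation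
unchanged. -/
theorem condCoverage_ae_eq (hZ : ∀ i, Measurable (Z i)) (hlaw : ∀ i, μ.map (Z i) = P)
    (hindep : iIndepFun Z μ) (A : Algorithm) :
    ∀ᵐ ω ∂μ, ∀ α₁ α₂ δ, condCoverage μ A Z α₁ α₂ δ ω = coverage A P (train Z ω) α₁ α₂ δ := by
  have hp := measurePreserving_train_newObs hZ hlaw hindep
  have ht := measurePreserving_train hZ hlaw hindep
  have hn : Measurable (newObs Z) := hZ _
  have h1 : ⇑(condDistrib (newObs Z) (train Z) μ) =ᵐ[μ.map (train Z)]
      ⇑(Kernel.const (Fin n → Obs p) P) := by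
    refine condDistrib_ae_eq_of_measure_eq_compProd (train Z) hn.aemeasurable ?_
    rw [Measure.compProd_const, hp.map_eq, ht.map_eq]
  filter_upwards [ae_of_ae_map ht.measurable.aemeasurable h1] with ω hω α₁ α₂ δ
  rw [condCoverage, hω]
  rfl

end Sample

/-! ### Limits along the sample size -/

section Limits

variable {Ω : ℕ → Type*} [∀ n, MeasurableSpace (Ω n)] {μ : ∀ n, Measure (Ω n)}
  [∀ n, IsProbabilityMeasure (μ n)] {p : ℕ → ℕ} {P : ∀ n, Measure (Obs (p n))}
  [∀ n, IsProbabilityMeasure (P n)] {Z : ∀ n, Fin (n + 1) → Ω n → Obs (p n)} {A : Algorithm}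

theorem tendsto_instability (hZ : ∀ n, 2 ≤ n → ∀ i, Measurable (Z n i))
    (hlaw : ∀ n, 2 ≤ n → ∀ i, (μ n).map (Z n i) = P n)
    (hindep : ∀ n, 2 ≤ n → iIndepFun (Z n) (μ n))
    (hA : ∀ p n, Measurable (Function.uncurry (A p n))) (hstable : Stable μ A Z) {e : ℝ}
    (he : 0 < e) : Tendsto (fun n => instability A n (P n) e) atTop (𝓝 0) := by
  refine (hstable e he).congr' ?_
  filter_upwards [eventually_ge_atTop 2] with n hn
  rw [instability]
  congr 1
  refine Finset.sum_congr rfl fun i _ => ?_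
  have hp := measurePreserving_train_newObs (hZ n hn) (hlaw n hn) (hindep n hn)
  have m := measurable_abs_pred_sub_predLoo hA (p := p n) i
  rw [measureReal_def, measureReal_def,
    ← hp.measure_preimage (measurableSet_le measurable_const m).nullMeasurableSet]
  rfl

/-- With probability tending to one, the error distribution and the empirical distribution of the
leave-one-out residuals are close up to a shift. -/
theorem eventually_exists_bad_set_shiftClose (hZ : ∀ n, 2 ≤ n → ∀ i, Measurable (Z n i))
    (hlaw : ∀ n, 2 ≤ n → ∀ i, (μ n).map (Z n i) = P n)
    (hindep : ∀ n, 2 ≤ n → iIndepFun (Z n) (μ n))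
    (hA : ∀ p n, Measurable (Function.uncurry (A p n)))
    (hbdd : StochBounded μ (fun n ω => ENNReal.ofReal |predError A (Z n) ω|))
    (hstable : Stable μ A Z) {d ε η : ℝ} (hd : 0 < d) (hε : 0 < ε) (hη : 0 < η) :
    ∀ᶠ n in atTop, ∃ B : Set (Fin n → Obs (p n)), (Measure.pi fun _ => P n).real B ≤ η ∧
      ∀ T ∉ B, ShiftClose (errorLaw A (P n) T) (ecdf A T) d ε := by
  obtain ⟨d, rfl⟩ : ∃ d', d = 2 * d' := ⟨d / 2, by ring⟩
  obtain ⟨ε, rfl⟩ : ∃ ε', ε = 2 * ε' := ⟨ε / 2, by ring⟩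
  replace hd : 0 < d := by linarith
  replace hε : 0 < ε := by linarith
  obtain ⟨K, hK⟩ := hbdd (ENNReal.ofReal (ε * (η / 2))) (ENNReal.ofReal_pos.2 (by positivity))
  obtain ⟨N, hN⟩ := exists_nat_ge ((2 * K + 2 * d) / d)
  rw [div_le_iff₀ hd] at hN
  -- this choice makes the Lipschitz part of the bound on the bad set equal to `η / 4`
  let e : ℝ := d * ε ^ 2 * η / (48 * (N + 2))
  have he : 0 < e := by positivity
  have hlim : Tendsto (fun n : ℕ =>
      ((N : ℝ) + 2) * ((1 / (n : ℝ) + 12 * (e / d + instability A n (P n) e)) / ε ^ 2)) atTop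
      (𝓝 (((N : ℝ) + 2) * ((0 + 12 * (e / d + 0)) / ε ^ 2))) :=
    ((tendsto_one_div_atTop_nhds_zero_nat.add
      ((tendsto_instability hZ hlaw hindep hA hstable he).const_add _ |>.const_mul _)).div_const
        _).const_mul _
  have hval : ((N : ℝ) + 2) * ((0 + 12 * (e / d + 0)) / ε ^ 2) < η / 2 := by
    have : ((N : ℝ) + 2) * ((0 + 12 * (e / d + 0)) / ε ^ 2) = η / 4 := by
      simp only [e]
      field_simp
      ring
    rw [this]
    linarith
  filter_upwards [eventually_ge_atTop 2, hlim.eventually_lt_const hval] with n hn hlt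
  obtain ⟨B, hB, hclose⟩ := exists_bad_set_shiftClose hA (by omega : 0 < n) (P n) hd he.le hε N hN
  refine ⟨B, hB.trans ?_, hclose⟩
  have hp := measurePreserving_train_newObs (hZ n hn) (hlaw n hn) (hindep n hn)
  have hW : ((Measure.pi fun _ => P n).prod (P n)).real
      {q : (Fin n → Obs (p n)) × Obs (p n) | (K : ℝ) < |q.2.1 - pred A q.1 q.2.2|}
      ≤ ε * (η / 2) := by
    refine ENNReal.toReal_le_of_le_ofReal (by positivity) ?_
    rw [← hp.measure_preimage
      (measurableSet_lt measurable_const (measurable_sub_pred hA).abs).nullMeasurableSet]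
    refine (measure_mono fun ω hω => ?_).trans (hK n hn)
    have hω' : (K : ℝ) < |predError A (Z n) ω| := hω
    change (K : ℝ≥0∞) < ENNReal.ofReal |predError A (Z n) ω|
    rwa [← ENNReal.ofReal_coe_nnreal, ENNReal.ofReal_lt_ofReal_iff_of_nonneg K.coe_nonneg]
  have hW' := (div_le_div_of_nonneg_right hW hε.le)
  rw [mul_div_cancel_left₀ _ hε.ne'] at hW'
  linarith

/-- Events, possibly not measurable, have probability tending to one if they contain, up to null
sets, the complements of small events about the training data. -/
theorem tendsto_measureReal_one (hZ : ∀ n, 2 ≤ n → ∀ i, Measurable (Z n i))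
    (hlaw : ∀ n, 2 ≤ n → ∀ i, (μ n).map (Z n i) = P n)
    (hindep : ∀ n, 2 ≤ n → iIndepFun (Z n) (μ n)) {S : ∀ n, Set (Ω n)}
    (hS : ∀ η : ℝ, 0 < η → ∀ᶠ n in atTop, ∃ B : Set (Fin n → Obs (p n)),
      (Measure.pi fun _ => P n).real B ≤ η ∧ ∀ᵐ ω ∂(μ n), train (Z n) ω ∉ B → ω ∈ S n) :
    Tendsto (fun n => (μ n).real (S n)) atTop (𝓝 1) := by
  refine tendsto_order.2 ⟨fun a ha => ?_, fun a ha =>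
    Eventually.of_forall fun n => measureReal_le_one.trans_lt ha⟩
  filter_upwards [eventually_ge_atTop 2, hS ((1 - a) / 2) (by linarith)] with n hn ⟨B, hB, hBS⟩
  have ht := measurePreserving_train (hZ n hn) (hlaw n hn) (hindep n hn)
  have h1 : (μ n).real (train (Z n) ⁻¹' B) ≤ (1 - a) / 2 := by
    refine le_trans (ENNReal.toReal_mono (measure_ne_top _ _) ?_) hB
    rw [← ht.map_eq]
    exact Measure.le_map_apply ht.measurable.aemeasurable _
  have h2 : (μ n).real Set.univ ≤ (μ n).real (S n ∪ train (Z n) ⁻¹' B) := by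
    refine ENNReal.toReal_mono (measure_ne_top _ _) (measure_mono_ae ?_)
    filter_upwards [hBS] with ω hω _
    by_cases hωB : train (Z n) ω ∈ B
    · exact Or.inr hωB
    · exact Or.inl (hω hωB)
  have h3 := measureReal_union_le (μ := μ n) (S n) (train (Z n) ⁻¹' B)
  rw [probReal_univ] at h2
  linarith

theorem integral_le_add_measureReal {S : Type*} [MeasurableSpace S] {m : Measure S}
    [IsProbabilityMeasure m] {f : S → ℝ} (hf : Measurable f) (hf1 : ∀ s, f s ∈ Set.Icc (0 : ℝ) 1)
    {B : Set S} {c : ℝ} (hc : 0 ≤ c) (hB : ∀ s ∉ B, f s ≤ c) : ∫ s, f s ∂m ≤ c + m.real B := by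
  have mB := measurableSet_toMeasurable m B
  have iB : Integrable ((toMeasurable m B).indicator (1 : S → ℝ)) m :=
    (integrable_const 1).indicator mB
  have hle : ∫ s, f s ∂m ≤ ∫ s, (c + (toMeasurable m B).indicator 1 s) ∂m := by
    refine integral_mono (integrable_of_measurable_of_abs_le hf (C := 1) fun s => ?_)
      ((integrable_const c).add iB) fun s => ?_
    · rw [abs_of_nonneg (hf1 s).1]; exact (hf1 s).2
    · by_cases hs : s ∈ toMeasurable m B
      · simp only [Set.indicator_of_mem hs, Pi.one_apply]
        linarith [(hf1 s).2]
      · simp only [Set.indicator_of_notMem hs, add_zero]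
        exact hB s fun h => hs (subset_toMeasurable _ _ h)
  rw [integral_add (integrable_const c) iB, integral_indicator_one mB] at hle
  simpa [measureReal_def, measure_toMeasurable] using hle

theorem iSup_abs_condCoverage_ae_eq {n : ℕ} (hZ : ∀ i, Measurable (Z n i))
    (hlaw : ∀ i, (μ n).map (Z n i) = P n) (hindep : iIndepFun (Z n) (μ n)) :
    (fun ω => ⨆ a : levels, |condCoverage (μ n) A (Z n) a.1.1 a.1.2 0 ω - (a.1.2 - a.1.1)|)
      =ᵐ[μ n] fun ω => supDeviation A (P n) (train (Z n) ω) := by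
  filter_upwards [condCoverage_ae_eq hZ hlaw hindep A] with ω hω
  simp only [hω, supDeviation]

/-- In the continuous case the largest deviation of the coverage tends to zero in mean. -/
theorem tendsto_integral_supDeviation (hZ : ∀ n, 2 ≤ n → ∀ i, Measurable (Z n i))
    (hlaw : ∀ n, 2 ≤ n → ∀ i, (μ n).map (Z n i) = P n)
    (hindep : ∀ n, 2 ≤ n → iIndepFun (Z n) (μ n))
    (hA : ∀ p n, Measurable (Function.uncurry (A p n)))
    (hbdd : StochBounded μ (fun n ω => ENNReal.ofReal |predError A (Z n) ω|))
    (hstable : Stable μ A Z) (hcc : ContinuousCase P) :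
    Tendsto (fun n => ∫ T : Fin n → Obs (p n), supDeviation A (P n) T ∂(Measure.pi fun _ => P n))
      atTop (𝓝 0) := by
  refine tendsto_order.2 ⟨fun a ha => Eventually.of_forall fun n =>
    ha.trans_le (integral_nonneg fun T => (supDeviation_mem A (P n) T).1), fun θ hθ => ?_⟩
  obtain ⟨K, hK⟩ := hcc.bounded (ENNReal.ofReal (θ / 8)) (ENNReal.ofReal_pos.2 (by positivity))
  -- intervals of length `δ` have error probability at most `K δ + θ / 8 ≤ θ / 4`
  let δ : ℝ := θ / (8 * (K + 1))
  have hδ : 0 < δ := by positivity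
  have hKδ : K * δ ≤ θ / 8 := by
    have : K * δ = K / (K + 1) * (θ / 8) := by simp only [δ]; field_simp
    rw [this]
    refine mul_le_of_le_one_left (by positivity) ((div_le_one (by positivity)).2 (by linarith))
  filter_upwards [eventually_ge_atTop 2, eventually_exists_bad_set_shiftClose hZ hlaw hindep hA hbdd
    hstable (d := δ / 3) (ε := θ / 8) (η := θ / 8) (by positivity) (by positivity) (by positivity)]
    with n hn ⟨B, hB, hclose⟩
  have hn0 : 0 < n := by omega
  refine (integral_le_add_measureReal (measurable_supDeviation hA hn0 (P n))
    (supDeviation_mem A (P n)) (B := B) (c := 3 * θ / 4) (by positivity) fun T hT => ?_).trans_lt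
    (by linarith)
  have hprob := isProbabilityMeasure_errorLaw hA (P n) T
  have hac : ∀ᵐ x ∂((P n).map Prod.snd), condLaw (P n) x ≪ volume :=
    (hcc.density n hn).mono fun x hx => hx.1
  have hQ := ((hclose T hT).quantileBounds (isCdfLike_ecdf A hn0 T) (by positivity) (by positivity)
    (by linarith : 3 * (δ / 3) ≤ δ)).zero_of_modulus (by positivity)
    (errorLaw_Icc_le hA (P n) hac (by positivity) (hK n hn) T hδ.le)
  refine ciSup_le fun ⟨a, ha0, ha12, ha1⟩ => ?_
  have h1 : a.1 ∈ Set.Icc (0 : ℝ) 1 := ⟨ha0, ha12.trans ha1⟩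
  have h2 : a.2 ∈ Set.Icc (0 : ℝ) 1 := ⟨ha0.trans ha12, ha1⟩
  have hlow := hQ.le_coverage h1 h2
  have hup := hQ.coverage_le (by positivity) h1 h2 ha12
  rw [neg_zero] at hup
  rw [coverage_eq_errorLaw hA, abs_le]
  constructor <;> linarith

end Limits

end Jackknife

theorem mainTheorem1
    {Ω : ℕ → Type*} [∀ n, MeasurableSpace (Ω n)]
    (μ : ∀ n, Measure (Ω n)) [∀ n, IsProbabilityMeasure (μ n)]
    (p : ℕ → ℕ)
    (P : ∀ n, Measure (Jackknife.Obs (p n))) [∀ n, IsProbabilityMeasure (P n)]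
    (Z : ∀ n, Fin (n + 1) → Ω n → Jackknife.Obs (p n))
    (hZ : ∀ n, 2 ≤ n → ∀ i, Measurable (Z n i))
    (hlaw : ∀ n, 2 ≤ n → ∀ i, (μ n).map (Z n i) = P n)
    (hindep : ∀ n, 2 ≤ n → iIndepFun (Z n) (μ n))
    (A : Jackknife.Algorithm)
    (hA : ∀ p n, Measurable (Function.uncurry (A p n)))
    (hbdd : Jackknife.StochBounded μ
      (fun n ω => ENNReal.ofReal |Jackknife.predError A (Z n) ω|))
    (hstable : Jackknife.Stable μ A Z) :
    (∀ δ : ℝ, 0 < δ →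
      (∀ ε : ℝ, 0 < ε →
        Tendsto (fun n => (μ n).real {ω | -ε ≤ ⨅ a : Jackknife.levels,
            (Jackknife.condCoverage (μ n) A (Z n) a.1.1 a.1.2 δ ω - (a.1.2 - a.1.1))})
          atTop (𝓝 1)) ∧
      (∀ ε : ℝ, 0 < ε →
        Tendsto (fun n => (μ n).real {ω | (⨆ a : Jackknife.levels,
            (Jackknife.condCoverage (μ n) A (Z n) a.1.1 a.1.2 (-δ) ω - (a.1.2 - a.1.1))) ≤ ε})
          atTop (𝓝 1))) ∧
    (Jackknife.ContinuousCase P →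
      (∀ n, 2 ≤ n → Integrable (fun ω => ⨆ a : Jackknife.levels,
          |Jackknife.condCoverage (μ n) A (Z n) a.1.1 a.1.2 0 ω - (a.1.2 - a.1.1)|) (μ n)) ∧
      Tendsto (fun n => ∫ ω, (⨆ a : Jackknife.levels,
          |Jackknife.condCoverage (μ n) A (Z n) a.1.1 a.1.2 0 ω - (a.1.2 - a.1.1)|) ∂(μ n))
        atTop (𝓝 0)) := by
  refine ⟨fun δ hδ => ?_, fun hcc => ⟨fun n hn => ?_, ?_⟩⟩
  · -- both halves of (i) hold off the same exceptional events
    have key : ∀ ε : ℝ, 0 < ε → ∀ η : ℝ, 0 < η → ∀ᶠ n in atTop,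
        ∃ B : Set (Fin n → Jackknife.Obs (p n)), (Measure.pi fun _ => P n).real B ≤ η ∧
          ∀ T ∉ B, ∀ a ∈ Jackknife.levels,
            -ε ≤ Jackknife.coverage A (P n) T a.1 a.2 δ - (a.2 - a.1) ∧
              Jackknife.coverage A (P n) T a.1 a.2 (-δ) - (a.2 - a.1) ≤ ε := by
      intro ε hε η hη
      filter_upwards [eventually_ge_atTop 2, Jackknife.eventually_exists_bad_set_shiftClose hZ hlaw
        hindep hA hbdd hstable (d := δ / 3) (ε := ε / 2) (by positivity) (by positivity) hη]
        with n hn ⟨B, hB, hclose⟩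
      refine ⟨B, hB, fun T hT a ⟨ha0, ha12, ha1⟩ => ?_⟩
      have hprob := Jackknife.isProbabilityMeasure_errorLaw hA (P n) T
      have hQ := (hclose T hT).quantileBounds (Jackknife.isCdfLike_ecdf A (by omega) T)
        (by positivity) (by positivity) (by linarith : 3 * (δ / 3) ≤ δ)
      have h1 : a.1 ∈ Set.Icc (0 : ℝ) 1 := ⟨ha0, ha12.trans ha1⟩
      have h2 : a.2 ∈ Set.Icc (0 : ℝ) 1 := ⟨ha0.trans ha12, ha1⟩
      have hlow := hQ.le_coverage h1 h2
      have hup := hQ.coverage_le (by positivity) h1 h2 ha12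
      rw [Jackknife.coverage_eq_errorLaw hA, Jackknife.coverage_eq_errorLaw hA]
      constructor <;> linarith
    refine ⟨fun ε hε => ?_, fun ε hε => ?_⟩ <;>
      refine Jackknife.tendsto_measureReal_one hZ hlaw hindep fun η hη => ?_ <;>
      filter_upwards [eventually_ge_atTop 2, key ε hε η hη] with n hn ⟨B, hB, hcov⟩ <;>
      refine ⟨B, hB, ?_⟩ <;>
      filter_upwards [Jackknife.condCoverage_ae_eq (hZ n hn) (hlaw n hn) (hindep n hn) A]
        with ω hω hωB
    · refine le_ciInf fun a => ?_
      rw [hω]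
      exact (hcov _ hωB a.1 a.2).1
    · refine ciSup_le fun a => ?_
      rw [hω]
      exact (hcov _ hωB a.1 a.2).2
  · refine Integrable.congr ?_ (Jackknife.iSup_abs_condCoverage_ae_eq (hZ n hn) (hlaw n hn)
      (hindep n hn)).symm
    have ht := Jackknife.measurePreserving_train (hZ n hn) (hlaw n hn) (hindep n hn)
    refine Jackknife.integrable_of_measurable_of_abs_le (C := 1)
      ((Jackknife.measurable_supDeviation hA (by omega) (P n)).comp ht.measurable) fun ω => ?_
    have hm := Jackknife.supDeviation_mem A (P n) (Jackknife.train (Z n) ω)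
    exact (abs_of_nonneg hm.1).trans_le hm.2
  · refine (Jackknife.tendsto_integral_supDeviation hZ hlaw hindep hA hbdd hstable hcc).congr' ?_
    filter_upwards [eventually_ge_atTop 2] with n hn
    have ht := Jackknife.measurePreserving_train (hZ n hn) (hlaw n hn) (hindep n hn)
    rw [integral_congr_ae (Jackknife.iSup_abs_condCoverage_ae_eq (hZ n hn) (hlaw n hn)
      (hindep n hn)), ← ht.map_eq, integral_map ht.measurable.aemeasurable
      (Jackknife.measurable_supDeviation hA (by omega) (P n)).aestronglyMeasurable]
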